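/- Proposition 4.1. Write a ternary sextic as $f=\sum_{i+j+k=6}c_{ijk}x^iy^jz^k$, with 28 coefficients $c_{ijk}$. There is an irreducible polynomial $\Delta\in\mathbb{Z}[c_{ijk}]$, the discriminant of ternary sextics, such that a sextic $f$ with complex coefficients satisfies $\Delta(f)=0$ if and only if there is a point of $\mathbb{C}^3\setminus\{0\}$ at which $f$ and its three partial derivatives vanish. Let $\Delta$ be any such polynomial; it is homogeneous of degree $75$. Let $R$ be a commutative ring and let $f$ be a ternary sextic with coefficients in $R$ (for example the general sextic, with $R=\mathbb{Z}[c_{ijk}]$, or any real sextic). For each quartic monomial $x^ry^sz^t$, $r+s+t=4$, let $M_{rst}$ be any $3\times 3$ matrix over $R[x,y,z]$ whose entries in the first, second and third column are forms of degree $4-r$, $4-s$ and $4-t$ respectively (zero being allowed), and such that $$\begin{pmatrix}\partial f/\partial x\\ \partial f/\partial y\\ \partial f/\partial z\end{pmatrix}=M_{rst}\begin{pmatrix}x^{r+1}\\ y^{s+1}\\ z^{t+1}\end{pmatrix}.$$ For the general sextic such matrices exist, with all coefficients of their entries linear forms in the $c_{ijk}$. Let $\mathcal{S}_f$ be the $45\times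 45$ matrix that represents, in monomial bases, the $R$-linear map $$(R[x,y,z]_3)^3\oplus R[x,y,z]_4\longrightarrow R[x,y,z]_8$$ given by $(a,b,c)\mapsto a\,\partial f/\partial x+b\,\partial f/\partial y+c\,\partial f/\partial z$ on the first summand and by $x^ry^sz^t\mapsto\det(M_{rst})$ on the second. Thus the first 30 columns hold the coefficients of the products of the partial derivatives with the cubic monomials, and the last 15 columns hold the coefficients of the octics $\det(M_{rst})$. Then $$\det(\mathcal{S}_f)=\pm\,6^{21}\,\Delta(f),$$ where the sign depends only on the choice of $\Delta$ (which is unique up to sign) and on the orderings of the monomial bases, not on $R$, $f$ or the matrices $M_{rst}$. (The columns may be listed in any order.) -/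

import Mathlib

open MvPolynomial Matrix

noncomputable section

namespace TernarySextic

/-- The exponents `(i, j, k)` of the monomials `x ^ i * y ^ j * z ^ k` of degree `d` in three
variables. -/
abbrev Mon (d : ℕ) : Type :=
  {m : Fin 3 →₀ ℕ // m ∈ Finset.finsuppAntidiag (Finset.univ : Finset (Fin 3)) d}

/-- There are `(d + 2).choose 2` monomials of degree `d` in three variables. -/
theorem card_mon (d : ℕ) : Fintype.card (Mon d) = (d + 2).choose 2 := by
  rw [Fintype.card_coe, Finset.card_finsuppAntidiag_nat_eq_choose, Finset.card_univ,
    Fintype.card_fin]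
  have h : 3 + d - 1 = d + 2 := by omega
  rw [h, ← Nat.choose_symm_add]

/-- There are 28 coefficients of a ternary sextic. -/
theorem card_mon_six : Fintype.card (Mon 6) = 28 := by
  rw [card_mon]
  decide

/-- The ternary sextic `∑ c_{ijk} x ^ i y ^ j z ^ k` with coefficients `c`. -/
def sextic {R : Type*} [CommRing R] (c : Mon 6 → R) : MvPolynomial (Fin 3) R :=
  ∑ m : Mon 6, monomial m.1 (c m)

/-- The complex plane curve defined by the sextic with coefficients `c` has a singular point. -/
def IsSingular (c : Mon 6 → ℂ) : Prop :=
  ∃ v : Fin 3 → ℂ, v ≠ 0 ∧ eval v (sextic c) = 0 ∧ ∀ i, eval v (pderiv i (sextic c)) = 0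

/-- `Δ` is a discriminant of ternary sextics: an irreducible polynomial over `ℤ` in the 28
coefficients (hence one without a nontrivial integer factor) which defines the hypersurface of
singular sextics. -/
structure IsDiscriminant (Δ : MvPolynomial (Mon 6) ℤ) : Prop where
  irreducible : Irreducible Δ
  zero_iff : ∀ c : Mon 6 → ℂ, aeval c Δ = 0 ↔ IsSingular c

/-- For `m = (r, s, t)` with `r + s + t = 4`: `M` is a `3 × 3` matrix of ternary forms with
`(∂f/∂x, ∂f/∂y, ∂f/∂z)ᵀ = M (x ^ (r + 1), y ^ (s + 1), z ^ (t + 1))ᵀ`.  The degrees of the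
entries are those that make this a homogeneous identity between forms of degree 5; as
`m k ≤ 4`, the subtraction below does not truncate. -/
structure IsBlock {R : Type*} [CommRing R] (c : Mon 6 → R) (m : Mon 4)
    (M : Matrix (Fin 3) (Fin 3) (MvPolynomial (Fin 3) R)) : Prop where
  isHomogeneous : ∀ i k, (M i k).IsHomogeneous (4 - m.1 k)
  identity : (fun i => pderiv i (sextic c)) = M *ᵥ (fun k => X k ^ (m.1 k + 1))

/-- Labels of the columns: the 30 monomials in the three summands of `(R[x,y,z]_3)^3` and the
15 monomials of `R[x,y,z]_4`. -/
abbrev Col : Type := (Fin 3 × Mon 3) ⊕ Mon 4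

/-- The octic to which the Sylvester map sends a monomial basis element. -/
def octic {R : Type*} [CommRing R] (c : Mon 6 → R)
    (M : Mon 4 → Matrix (Fin 3) (Fin 3) (MvPolynomial (Fin 3) R)) :
    Col → MvPolynomial (Fin 3) R
  | Sum.inl (i, m) => monomial m.1 1 * pderiv i (sextic c)
  | Sum.inr m => (M m).det

/-- The `45 × 45` Sylvester matrix, for given orderings of the two monomial bases: its columns
hold the coefficients of the octics above. -/
def sylvester {R : Type*} [CommRing R] (c : Mon 6 → R)
    (M : Mon 4 → Matrix (Fin 3) (Fin 3) (MvPolynomial (Fin 3) R))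
    (rows : Fin 45 ≃ Mon 8) (cols : Fin 45 ≃ Col) : Matrix (Fin 45) (Fin 45) R :=
  Matrix.of fun a b => coeff (rows a).1 (octic c M (cols b))

/-- There are 45 row labels. -/
theorem card_mon_eight : Fintype.card (Mon 8) = 45 := by
  rw [card_mon]
  decide

/-- There are 45 column labels. -/
theorem card_col : Fintype.card Col = 45 := by
  have h3 : Fintype.card (Mon 3) = 10 := by
    rw [card_mon]
    decide
  have h4 : Fintype.card (Mon 4) = 15 := by
    rw [card_mon]
    decide
  rw [Fintype.card_sum, Fintype.card_prod, Fintype.card_fin, h3, h4]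

end TernarySextic

end

/-!
Let `v` be the vector of the powers `x ^ (r + 1), y ^ (s + 1), z ^ (t + 1)` and let
`∇f = M v = M' v`. The rows of `M' - M` are syzygies of `v`, hence cross products with `v`, and
expanding the determinants gives `det M' - det M` as a combination of the partial derivatives of
`f`. So the Sylvester determinant does not depend on the blocks
(`det_sylvester_eq`), and it is the value at `f` of one integral polynomial `D`, the Sylvester
determinant of the general sextic with its `standardBlock`s; `D` has degree `30 + 3 * 15 = 75`.
It remains to show `D = ± 6 ^ 21 Δ`. Four facts do this.

* Over `ℂ`, `D` vanishes exactly at the singular sextics (`aeval_genericDet_eq_zero_iff`). At a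
  singular point all the octics vanish. Conversely, if the partial derivatives have no common zero,
  then their ideal `J` contains powers of the variables; the derivatives form a regular sequence, so
  they have no syzygies of degree `3`. Moreover `x ^ r y ^ s z ^ t det M_rst` is not in `J`, whereas
  by Cramer's rule `x ^ r y ^ s z ^ t det M_uvw` is in `J` for `(u, v, w) ≠ (r, s, t)`.
  Together this makes the columns linearly independent.
* The singular sextics are the image of an affine space, so that the integral polynomials vanishing
  on them form a prime ideal (`VanishesOnSingular.or_of_mul`). An irreducible factor of `D` in this
  ideal is a discriminant. For every discriminant `Δ`, the Nullstellensatz over `ℚ` and unique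
  factorization in `ℤ[c]` give `D = k Δ ^ e` for an integer `k`
  (`IsDiscriminant.exists_eq_C_mul_pow`).
* `6 ^ 21` divides `D` (`six_pow_dvd_det_sylvester`). Euler's relation `∑ x_i ∂f/∂x_i = 6 f` is a
  relation modulo `6` between the first columns for each of the 6 quadratic monomials, and modulo
  `6` it also puts the 15 octics `det M_rst` into the ideal of the partial derivatives. By Gauss's
  lemma `6 ^ 21` then divides `k`.
* For `a x⁶ + y⁶ + z⁶` the value of `D` is `± 6 ^ 75 a ^ 25`, and for `x⁵y + y⁵z + d z⁶` it is
  `± 5 ^ 45 6 ^ 21 d ^ 21` (`aeval_fermat_genericDet`, `aeval_chain_genericDet`). As `6` and `5`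
  are coprime, `a = d = 1` shows `k = ± 6 ^ 21`; as `25` and `21` are coprime, `a = d = 7` shows
  `e = 1`.
-/

noncomputable section

namespace TernarySextic

/-! ### Syzygies of powers of the variables -/

/-- Powers of the variables in different variables form a regular sequence. -/
theorem mem_span_X_pow_of_mul_X_pow_mem {R : Type*} [CommRing R] (a : Fin 3 → ℕ) (T : Set (Fin 3))
    {j : Fin 3} (hj : j ∉ T) (b : ℕ) {p : MvPolynomial (Fin 3) R}
    (h : p * X j ^ b ∈ Ideal.span ((fun i => (X i ^ a i : MvPolynomial (Fin 3) R)) '' T)) :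
    p ∈ Ideal.span ((fun i => (X i ^ a i : MvPolynomial (Fin 3) R)) '' T) := by
  have key : (fun i => (X i ^ a i : MvPolynomial (Fin 3) R)) '' T =
      (fun s => monomial s (1 : R)) '' ((fun i => Finsupp.single i (a i)) '' T) := by
    rw [Set.image_image]
    simp only [X_pow_eq_monomial]
  rw [key, mem_ideal_span_monomial_image] at h ⊢
  intro m hm
  obtain ⟨_, ⟨i, hi, rfl⟩, hle⟩ := h (m + Finsupp.single j b) (by
    rw [mem_support_iff, X_pow_eq_monomial, coeff_mul_monomial, mul_one]
    exact mem_support_iff.1 hm)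
  refine ⟨_, ⟨i, hi, rfl⟩, ?_⟩
  have hij : i ≠ j := fun e => hj (e ▸ hi)
  rw [Finsupp.single_le_iff] at hle ⊢
  simpa [Finsupp.single_apply, hij.symm] using hle

/-- The Koszul complex of powers of the variables is exact in the middle: syzygies are cross
products. -/
theorem exists_eq_cross_of_sum_mul_X_pow_eq_zero {R : Type*} [CommRing R] (a : Fin 3 → ℕ)
    (u : Fin 3 → MvPolynomial (Fin 3) R) (h : ∑ i, u i * X i ^ a i = 0) :
    ∃ w : Fin 3 → MvPolynomial (Fin 3) R, u = w ⨯₃ (fun i => X i ^ a i) := by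
  rw [Fin.sum_univ_three] at h
  have h2 : u 2 ∈ Ideal.span ((fun i => (X i ^ a i : MvPolynomial (Fin 3) R)) '' {0, 1}) := by
    refine mem_span_X_pow_of_mul_X_pow_mem a {0, 1} (j := 2) (by simp) (a 2) ?_
    rw [Set.image_pair, Ideal.mem_span_pair]
    exact ⟨-u 0, -u 1, by linear_combination -h⟩
  rw [Set.image_pair, Ideal.mem_span_pair] at h2
  obtain ⟨p, q, hpq⟩ := h2
  have h1 : u 1 + q * X 2 ^ a 2 ∈
      Ideal.span ((fun i => (X i ^ a i : MvPolynomial (Fin 3) R)) '' {0}) := by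
    refine mem_span_X_pow_of_mul_X_pow_mem a {0} (j := 1) (by simp) (a 1) ?_
    rw [Set.image_singleton, Ideal.mem_span_singleton']
    exact ⟨-u 0 - p * X 2 ^ a 2, by linear_combination -h - X 2 ^ a 2 * hpq⟩
  rw [Set.image_singleton, Ideal.mem_span_singleton'] at h1
  obtain ⟨r, hr⟩ := h1
  have h0 : u 0 + p * X 2 ^ a 2 = - (r * X 1 ^ a 1) := by
    have hreg : IsRightRegular (X 0 ^ a 0 : MvPolynomial (Fin 3) R) := by
      rw [X_pow_eq_monomial]
      intro s t hst
      ext m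
      have := congrArg (coeff (m + Finsupp.single 0 (a 0))) hst
      simpa using this
    refine hreg ?_
    change (u 0 + p * X 2 ^ a 2) * X 0 ^ a 0 = - (r * X 1 ^ a 1) * X 0 ^ a 0
    linear_combination h + X 1 ^ a 1 * hr + X 2 ^ a 2 * hpq
  refine ⟨![q, -p, r], ?_⟩
  funext i
  fin_cases i
  · simp [cross_apply]; linear_combination h0
  · simp [cross_apply]; linear_combination -hr
  · simp [cross_apply]; linear_combination -hpq

/-- Changing the rows of a matrix `M` with `M *ᵥ v = f` by cross products with `v` changes the
determinant by a combination of the entries of `f`. -/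
theorem exists_det_sub_det_of_sub_eq_cross {A : Type*} [CommRing A]
    (M M' : Matrix (Fin 3) (Fin 3) A) (v f : Fin 3 → A) (hM : f = M *ᵥ v) (w : Fin 3 → Fin 3 → A)
    (hw : ∀ i, M' i - M i = w i ⨯₃ v) : ∃ u : Fin 3 → A, M'.det - M.det = ∑ i, u i * f i := by
  have e : ∀ i, f i = M i 0 * v 0 + M i 1 * v 1 + M i 2 * v 2 := fun i => by
    rw [hM, mulVec, dotProduct, Fin.sum_univ_three]
  have d : ∀ i, M' i = M i + w i ⨯₃ v := fun i => by rw [← hw]; ring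
  let N (i j : Fin 3) : A := w i 0 * M j 0 + w i 1 * M j 1 + w i 2 * M j 2
  let N' (i j : Fin 3) : A := w i 0 * M' j 0 + w i 1 * M' j 1 + w i 2 * M' j 2
  refine ⟨![N' 1 2 - N 2 1, N 2 0 - N' 0 2, N' 0 1 - N 1 0], ?_⟩
  rw [det_fin_three, det_fin_three, Fin.sum_univ_three]
  simp only [N, N', d, e, cross_apply, Pi.add_apply]
  simp
  ring

/-- Two matrices `M`, `M'` with `M v = M' v = f` for powers `v` of the variables have the same
determinant modulo the ideal of the entries of `f`. -/
theorem exists_det_sub_det {R : Type*} [CommRing R] (a : Fin 3 → ℕ)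
    (M M' : Matrix (Fin 3) (Fin 3) (MvPolynomial (Fin 3) R)) (f : Fin 3 → MvPolynomial (Fin 3) R)
    (hM : f = M *ᵥ fun i => X i ^ a i) (hM' : f = M' *ᵥ fun i => X i ^ a i) :
    ∃ u : Fin 3 → MvPolynomial (Fin 3) R, M'.det - M.det = ∑ i, u i * f i := by
  have h : ∀ i, ∃ w : Fin 3 → MvPolynomial (Fin 3) R, M' i - M i = w ⨯₃ (fun i => X i ^ a i) := by
    intro i
    refine exists_eq_cross_of_sum_mul_X_pow_eq_zero a _ ?_
    have := congrFun (hM.symm.trans hM') i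
    simp only [mulVec, dotProduct] at this
    simp only [Pi.sub_apply, sub_mul, Finset.sum_sub_distrib, this, sub_self]
  choose w hw using h
  exact exists_det_sub_det_of_sub_eq_cross M M' _ f hM w hw

attribute [local instance] MvPolynomial.gradedAlgebra in
theorem homogeneousComponent_mul_of_isHomogeneous {σ R : Type*} [CommRing R] {n d : ℕ}
    (u : MvPolynomial σ R) {f : MvPolynomial σ R} (hf : f.IsHomogeneous d) :
    homogeneousComponent (n + d) (u * f) = homogeneousComponent n u * f := by
  have := DirectSum.coe_decompose_mul_add_of_right_mem (homogeneousSubmodule σ R) (a := u) (i := n)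
    ((mem_homogeneousSubmodule d f).2 hf)
  rw [← decomposition.decompose'_apply, ← decomposition.decompose'_apply]
  exact this

theorem exists_isHomogeneous_of_eq_sum {σ ι R : Type*} [CommRing R] [Fintype ι] {n d : ℕ}
    {F : MvPolynomial σ R} (hF : F.IsHomogeneous (n + d)) {u f : ι → MvPolynomial σ R}
    (hf : ∀ i, (f i).IsHomogeneous d) (h : F = ∑ i, u i * f i) :
    ∃ u' : ι → MvPolynomial σ R, (∀ i, (u' i).IsHomogeneous n) ∧ F = ∑ i, u' i * f i := by
  refine ⟨fun i => homogeneousComponent n (u i), fun i => homogeneousComponent_isHomogeneous _ _,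
    ?_⟩
  rw [← homogeneousComponent_eq_self hF, h, map_sum]
  exact Finset.sum_congr rfl fun i _ => homogeneousComponent_mul_of_isHomogeneous _ (hf i)

/-! ### Independence of the blocks -/

theorem mon_degree {d : ℕ} (m : Mon d) : m.1.degree = d := by
  have := (Finset.mem_finsuppAntidiag.1 m.2).1
  rwa [Finsupp.degree_eq_sum]

theorem mem_mon_iff {d : ℕ} (m : Fin 3 →₀ ℕ) :
    m ∈ Finset.finsuppAntidiag (Finset.univ : Finset (Fin 3)) d ↔ m.degree = d := by
  rw [Finset.mem_finsuppAntidiag, Finsupp.degree_eq_sum]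
  simp

theorem mon_sum {d : ℕ} (m : Mon d) : m.1 0 + m.1 1 + m.1 2 = d := by
  have := mon_degree m
  rwa [Finsupp.degree_eq_sum, Fin.sum_univ_three] at this

theorem mon_le {d : ℕ} (m : Mon d) (i : Fin 3) : m.1 i ≤ d := by
  have := mon_sum m
  fin_cases i <;> simp <;> omega

theorem sum_monomial_coeff {R : Type*} [CommRing R] {d : ℕ} {p : MvPolynomial (Fin 3) R}
    (hp : p.IsHomogeneous d) : ∑ m : Mon d, monomial m.1 (coeff m.1 p) = p := by
  ext a
  rw [coeff_sum]
  simp only [coeff_monomial]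
  by_cases ha : a.degree = d
  · rw [Finset.sum_eq_single ⟨a, (mem_mon_iff a).2 ha⟩]
    · simp
    · intro b _ hb
      rw [if_neg]
      rintro rfl
      exact hb rfl
    · simp
  · rw [hp.coeff_eq_zero ha]
    refine Finset.sum_eq_zero fun b _ => if_neg ?_
    rintro rfl
    exact ha (mon_degree b)

theorem coeff_sum_monomial {R : Type*} [CommRing R] {d : ℕ} (c : Mon d → R) (m : Mon d) :
    coeff m.1 (∑ u : Mon d, monomial u.1 (c u)) = c m := by
  rw [coeff_sum, Finset.sum_eq_single m]
  · simp
  · intro b _ hb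
    rw [coeff_monomial, if_neg fun h => hb (Subtype.ext h)]
  · simp

theorem isHomogeneous_sextic {R : Type*} [CommRing R] (c : Mon 6 → R) :
    (sextic c).IsHomogeneous 6 :=
  IsHomogeneous.sum _ _ _ fun m _ => isHomogeneous_monomial _ (mon_degree m)

theorem isHomogeneous_pderiv_sextic {R : Type*} [CommRing R] (c : Mon 6 → R) (i : Fin 3) :
    (pderiv i (sextic c)).IsHomogeneous 5 :=
  (isHomogeneous_sextic c).pderiv

theorem IsBlock.isHomogeneous_det {R : Type*} [CommRing R] {c : Mon 6 → R} {m : Mon 4}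
    {M : Matrix (Fin 3) (Fin 3) (MvPolynomial (Fin 3) R)} (h : IsBlock c m M) :
    M.det.IsHomogeneous 8 := by
  rw [det_apply]
  refine IsHomogeneous.sum _ _ _ fun σ _ => ?_
  rw [Units.smul_def, zsmul_eq_mul, ← map_intCast (C : R →+* _)]
  refine IsHomogeneous.C_mul ?_ _
  have := IsHomogeneous.prod Finset.univ (fun i => M (σ i) i) (fun i => 4 - m.1 i)
    fun i _ => h.isHomogeneous _ _
  convert this using 1
  have := mon_sum m
  rw [Fin.sum_univ_three]
  omega

theorem isHomogeneous_octic {R : Type*} [CommRing R] {c : Mon 6 → R}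
    {M : Mon 4 → Matrix (Fin 3) (Fin 3) (MvPolynomial (Fin 3) R)} (h : ∀ m, IsBlock c m (M m))
    (j : Col) : (octic c M j).IsHomogeneous 8 := by
  rcases j with ⟨i, m⟩ | m
  · exact (isHomogeneous_monomial (n := 3) _ (mon_degree m)).mul (isHomogeneous_pderiv_sextic c i)
  · exact (h m).isHomogeneous_det

/-- The Sylvester matrix with rows and columns labelled by monomials. -/
def octicMatrix {R : Type*} [CommRing R] (c : Mon 6 → R)
    (M : Mon 4 → Matrix (Fin 3) (Fin 3) (MvPolynomial (Fin 3) R)) : Matrix (Mon 8) Col R :=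
  Matrix.of fun a b => coeff a.1 (octic c M b)

theorem sylvester_eq_submatrix {R : Type*} [CommRing R] (c : Mon 6 → R)
    (M : Mon 4 → Matrix (Fin 3) (Fin 3) (MvPolynomial (Fin 3) R))
    (rows : Fin 45 ≃ Mon 8) (cols : Fin 45 ≃ Col) :
    sylvester c M rows cols = (octicMatrix c M).submatrix rows cols := rfl

/-- A matrix whose off-diagonal entries `U i j` vanish unless the level of `i` is less than the
level of `j` is triangular for any ordering of the indices by level, so its determinant is the
product of its diagonal. -/
theorem det_eq_prod_diag_of_level {n R : Type*} [Fintype n] [DecidableEq n] [CommRing R]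
    (U : Matrix n n R) (level : n → ℕ) (h : ∀ i j, U i j ≠ 0 → i = j ∨ level i < level j) :
    U.det = ∏ i, U i i := by
  rw [det_apply, Finset.sum_eq_single 1]
  · simp
  · intro σ _ hσ
    have : ∏ i, U (σ i) i = 0 := by
      by_contra hne
      have h0 : ∀ i, U (σ i) i ≠ 0 := fun i hi => hne (Finset.prod_eq_zero (Finset.mem_univ i) hi)
      have hle : ∀ i ∈ Finset.univ, level (σ i) ≤ level i := fun i _ => by
        rcases h _ _ (h0 i) with e | e
        · rw [e]
        · exact e.le
      have heq := (Finset.sum_eq_sum_iff_of_le hle).1 (Equiv.sum_comp σ level)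
      refine hσ (Equiv.ext fun i => ?_)
      rcases h _ _ (h0 i) with e | e
      · exact e
      · exact absurd (heq i (Finset.mem_univ i)) e.ne
    rw [this, smul_zero]
  · simp

theorem exists_coeffs_of_isHomogeneous {R : Type*} [CommRing R] {F : MvPolynomial (Fin 3) R}
    (hF : F.IsHomogeneous 8) {f u : Fin 3 → MvPolynomial (Fin 3) R}
    (hf : ∀ i, (f i).IsHomogeneous 5) (h : F = ∑ i, u i * f i) :
    ∃ k : Fin 3 × Mon 3 → R, F = ∑ x, C (k x) * (monomial x.2.1 1 * f x.1) := by
  obtain ⟨v, hv, e⟩ := exists_isHomogeneous_of_eq_sum (n := 3) (d := 5) hF hf h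
  refine ⟨fun x => coeff x.2.1 (v x.1), ?_⟩
  rw [e, Fintype.sum_prod_type]
  refine Finset.sum_congr rfl fun i _ => ?_
  conv_lhs => rw [← sum_monomial_coeff (hv i), Finset.sum_mul]
  refine Finset.sum_congr rfl fun m _ => ?_
  rw [← mul_assoc, C_mul_monomial, mul_one]

/-- The determinant of the Sylvester matrix does not depend on the choice of the blocks. -/
theorem det_sylvester_eq {R : Type*} [CommRing R] {c : Mon 6 → R}
    {M M' : Mon 4 → Matrix (Fin 3) (Fin 3) (MvPolynomial (Fin 3) R)}
    (h : ∀ m, IsBlock c m (M m)) (h' : ∀ m, IsBlock c m (M' m))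
    (rows : Fin 45 ≃ Mon 8) (cols : Fin 45 ≃ Col) :
    (sylvester c M' rows cols).det = (sylvester c M rows cols).det := by
  have hk : ∀ m, ∃ k : Fin 3 × Mon 3 → R,
      (M' m).det - (M m).det = ∑ x, C (k x) * (monomial x.2.1 1 * pderiv x.1 (sextic c)) := by
    intro m
    obtain ⟨u, hu⟩ := exists_det_sub_det (fun k => m.1 k + 1) (M m) (M' m) _
      (h m).identity (h' m).identity
    exact exists_coeffs_of_isHomogeneous (f := fun i => pderiv i (sextic c))
      ((h' m).isHomogeneous_det.sub (h m).isHomogeneous_det)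
      (fun i => isHomogeneous_pderiv_sextic c i) hu
  choose k hk using hk
  -- the column operations that turn one Sylvester matrix into the other
  let U : Matrix Col Col R := fromBlocks 1 (of fun x m => k m x) 0 1
  have hU : U.det = 1 := by simp [U]
  have hmul : octicMatrix c M' = octicMatrix c M * U := by
    ext a j
    rw [mul_apply, Fintype.sum_sum_type]
    rcases j with x | m
    · simp [U, octicMatrix, octic, one_apply]
    · have e : (M' m).det = (M m).det +
          ∑ x, C (k m x) * (monomial x.2.1 1 * pderiv x.1 (sextic c)) := by rw [← hk]; ring
      simp only [U, octicMatrix, octic, of_apply, e, fromBlocks_apply₁₂, fromBlocks_apply₂₂,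
        one_apply, coeff_add, coeff_sum, coeff_C_mul, mul_ite, mul_one, mul_zero,
        Finset.sum_ite_eq', Finset.mem_univ, if_true]
      rw [add_comm]
      congr 1
      exact Finset.sum_congr rfl fun x _ => mul_comm _ _
  rw [sylvester_eq_submatrix, hmul, ← submatrix_mul_equiv _ _ rows cols cols, det_mul,
    det_submatrix_equiv_self, hU, mul_one, ← sylvester_eq_submatrix]

theorem sextic_map {R R' : Type*} [CommRing R] [CommRing R'] (φ : R →+* R') (c : Mon 6 → R) :
    sextic (fun m => φ (c m)) = MvPolynomial.map φ (sextic c) := by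
  simp [sextic, map_sum, map_monomial]

theorem IsBlock.map {R R' : Type*} [CommRing R] [CommRing R'] (φ : R →+* R') {c : Mon 6 → R}
    {m : Mon 4} {M : Matrix (Fin 3) (Fin 3) (MvPolynomial (Fin 3) R)} (h : IsBlock c m M) :
    IsBlock (fun u => φ (c u)) m (M.map (MvPolynomial.map φ)) where
  isHomogeneous i k := (h.isHomogeneous i k).map φ
  identity := by
    funext i
    have := congrArg (MvPolynomial.map φ) (congrFun h.identity i)
    rw [sextic_map, pderiv_map, this]
    simp [mulVec, dotProduct]

theorem sylvester_map {R R' : Type*} [CommRing R] [CommRing R'] (φ : R →+* R') (c : Mon 6 → R)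
    (M : Mon 4 → Matrix (Fin 3) (Fin 3) (MvPolynomial (Fin 3) R))
    (rows : Fin 45 ≃ Mon 8) (cols : Fin 45 ≃ Col) :
    sylvester (fun u => φ (c u)) (fun m => (M m).map (MvPolynomial.map φ)) rows cols =
      (sylvester c M rows cols).map φ := by
  ext a b
  simp only [sylvester, of_apply, Matrix.map_apply]
  rcases cols b with ⟨i, m⟩ | m
  · simp only [octic]
    rw [sextic_map, pderiv_map, ← coeff_map, _root_.map_mul, map_monomial, φ.map_one]
  · simp only [octic]
    rw [← coeff_map, RingHom.map_det, RingHom.mapMatrix_apply]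

/-! ### Blocks of the general sextic -/

/-- A quintic monomial is divisible by one of `x ^ (r + 1)`, `y ^ (s + 1)`, `z ^ (t + 1)`, as
`r + s + t < 5`. -/
theorem exists_lt_exponent (m : Mon 4) (u : Mon 5) : ∃ k, m.1 k + 1 ≤ u.1 k := by
  by_contra! h
  have h0 := h 0
  have h1 := h 1
  have h2 := h 2
  have := mon_sum m
  have := mon_sum u
  omega

/-- For every quintic monomial a variable `x_k` such that `x_k ^ (m k + 1)` divides it. -/
def divisorIndex (m : Mon 4) (u : Mon 5) : Fin 3 := (exists_lt_exponent m u).choose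

theorem le_divisorIndex (m : Mon 4) (u : Mon 5) :
    m.1 (divisorIndex m u) + 1 ≤ u.1 (divisorIndex m u) := (exists_lt_exponent m u).choose_spec

/-- The block that collects the terms of the partial derivatives according to `divisorIndex`. -/
def standardBlock {R : Type*} [CommRing R] (c : Mon 6 → R) (m : Mon 4) :
    Matrix (Fin 3) (Fin 3) (MvPolynomial (Fin 3) R) :=
  of fun i k => ∑ u : Mon 5, if divisorIndex m u = k then
    monomial (u.1 - Finsupp.single k (m.1 k + 1)) (coeff u.1 (pderiv i (sextic c))) else 0

theorem isBlock_standardBlock {R : Type*} [CommRing R] (c : Mon 6 → R) (m : Mon 4) :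
    IsBlock c m (standardBlock c m) where
  isHomogeneous i k := by
    rw [standardBlock, of_apply]
    refine IsHomogeneous.sum _ _ _ fun u _ => ?_
    split_ifs with h
    · subst h
      refine isHomogeneous_monomial _ ?_
      have hle := le_divisorIndex m u
      set k := divisorIndex m u
      have := congrArg Finsupp.degree (tsub_add_cancel_of_le (Finsupp.single_le_iff.2 hle))
      rw [map_add, Finsupp.degree_single, mon_degree] at this
      omega
    · exact isHomogeneous_zero _ _ _
  identity := by
    funext i
    simp only [mulVec, dotProduct, standardBlock, of_apply, Finset.sum_mul]
    rw [Finset.sum_comm]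
    conv_lhs => rw [← sum_monomial_coeff (isHomogeneous_pderiv_sextic c i)]
    refine Finset.sum_congr rfl fun u _ => ?_
    rw [Finset.sum_eq_single (divisorIndex m u)]
    · rw [if_pos rfl, X_pow_eq_monomial, monomial_mul, mul_one,
        tsub_add_cancel_of_le (Finsupp.single_le_iff.2 (le_divisorIndex m u))]
    · intro k _ hk
      rw [if_neg hk.symm, zero_mul]
    · simp

/-- All coefficients of the ternary polynomial `p`, themselves polynomials in the variables `σ`,
are homogeneous of degree `n`. -/
def CoeffsHomogeneous {σ : Type*} (n : ℕ) (p : MvPolynomial (Fin 3) (MvPolynomial σ ℤ)) : Prop :=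
  ∀ a, (coeff a p).IsHomogeneous n

theorem CoeffsHomogeneous.mul {σ : Type*} {n n' : ℕ}
    {p q : MvPolynomial (Fin 3) (MvPolynomial σ ℤ)} (hp : CoeffsHomogeneous n p)
    (hq : CoeffsHomogeneous n' q) : CoeffsHomogeneous (n + n') (p * q) := fun a => by
  rw [coeff_mul]
  exact IsHomogeneous.sum _ _ _ fun x _ => (hp _).mul (hq _)

theorem CoeffsHomogeneous.monomial {σ : Type*} {n : ℕ} {r : MvPolynomial σ ℤ}
    (hr : r.IsHomogeneous n) (s : Fin 3 →₀ ℕ) :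
    CoeffsHomogeneous n (monomial s r) := fun a => by
  rw [coeff_monomial]
  split_ifs
  · exact hr
  · exact isHomogeneous_zero _ _ _

theorem CoeffsHomogeneous.sum {σ ι : Type*} {n : ℕ} (s : Finset ι)
    {p : ι → MvPolynomial (Fin 3) (MvPolynomial σ ℤ)} (hp : ∀ i ∈ s, CoeffsHomogeneous n (p i)) :
    CoeffsHomogeneous n (∑ i ∈ s, p i) := fun a => by
  rw [coeff_sum]
  exact IsHomogeneous.sum _ _ _ fun i hi => hp i hi a

theorem coeffsHomogeneous_pderiv_sextic_X (i : Fin 3) :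
    CoeffsHomogeneous 1 (pderiv i (sextic (fun u => (X u : MvPolynomial (Mon 6) ℤ)))) := by
  rw [sextic, map_sum]
  refine CoeffsHomogeneous.sum _ fun m _ => ?_
  rw [pderiv_monomial]
  refine CoeffsHomogeneous.monomial ?_ _
  rw [mul_comm, ← map_natCast (C : ℤ →+* _)]
  exact (isHomogeneous_X _ _).C_mul _

theorem coeffsHomogeneous_standardBlock_X (m : Mon 4) (i k : Fin 3) :
    CoeffsHomogeneous 1 (standardBlock (fun u => (X u : MvPolynomial (Mon 6) ℤ)) m i k) := by
  rw [standardBlock, of_apply]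
  refine CoeffsHomogeneous.sum _ fun u _ => ?_
  split_ifs
  · exact CoeffsHomogeneous.monomial (coeffsHomogeneous_pderiv_sextic_X i _) _
  · intro a
    exact isHomogeneous_zero _ _ _

theorem CoeffsHomogeneous.det {σ : Type*}
    {M : Matrix (Fin 3) (Fin 3) (MvPolynomial (Fin 3) (MvPolynomial σ ℤ))}
    (h : ∀ i k, CoeffsHomogeneous 1 (M i k)) : CoeffsHomogeneous 3 M.det := by
  rw [det_fin_three]
  intro a
  have key : ∀ i j k i' j' k', (coeff a (M i i' * M j j' * M k k')).IsHomogeneous 3 :=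
    fun i j k i' j' k' => (((h i i').mul (h j j')).mul (h k k')) a
  simp only [coeff_add, coeff_sub]
  exact (((((key _ _ _ _ _ _).sub (key _ _ _ _ _ _)).sub (key _ _ _ _ _ _)).add
    (key _ _ _ _ _ _)).add (key _ _ _ _ _ _)).sub (key _ _ _ _ _ _)

/-- The Sylvester determinant of the general sextic, for the standard blocks. -/
def genericDet (rows : Fin 45 ≃ Mon 8) (cols : Fin 45 ≃ Col) : MvPolynomial (Mon 6) ℤ :=
  (sylvester (fun u => (X u : MvPolynomial (Mon 6) ℤ)) (standardBlock fun u => X u) rows cols).det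

theorem card_mon_two : Fintype.card (Mon 2) = 6 := by
  rw [card_mon]
  decide

theorem card_mon_three : Fintype.card (Mon 3) = 10 := by
  rw [card_mon]
  decide

theorem card_mon_four : Fintype.card (Mon 4) = 15 := by
  rw [card_mon]
  decide

theorem isHomogeneous_genericDet (rows : Fin 45 ≃ Mon 8) (cols : Fin 45 ≃ Col) :
    (genericDet rows cols).IsHomogeneous 75 := by
  rw [genericDet, det_apply]
  refine IsHomogeneous.sum _ _ _ fun σ _ => ?_
  rw [Units.smul_def, zsmul_eq_mul, ← map_intCast (C : ℤ →+* _)]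
  refine IsHomogeneous.C_mul ?_ _
  let w : Col → ℕ := Sum.elim (fun _ => 1) (fun _ => 3)
  have := IsHomogeneous.prod Finset.univ
    (fun i => sylvester (fun u => (X u : MvPolynomial (Mon 6) ℤ)) (standardBlock fun u => X u) rows
      cols (σ i) i) (fun i => w (cols i)) fun i _ => by
        simp only [sylvester, of_apply]
        rcases cols i with ⟨j, m⟩ | m
        · simpa [w, octic] using (CoeffsHomogeneous.monomial (isHomogeneous_one _ _) _).mul
            (coeffsHomogeneous_pderiv_sextic_X j) (rows (σ i)).1
        · exact CoeffsHomogeneous.det (coeffsHomogeneous_standardBlock_X m) _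
  convert this using 1
  rw [Equiv.sum_comp cols w, Fintype.sum_sum_type]
  simp only [w, Sum.elim_inl, Sum.elim_inr, Finset.sum_const, Finset.card_univ, Fintype.card_prod,
    Fintype.card_fin, card_mon_three, card_mon_four, smul_eq_mul]

/-- The Sylvester determinant of any sextic, for any blocks, is a value of `genericDet`. -/
theorem det_sylvester_eq_aeval_genericDet {R : Type*} [CommRing R] {c : Mon 6 → R}
    {M : Mon 4 → Matrix (Fin 3) (Fin 3) (MvPolynomial (Fin 3) R)} (h : ∀ m, IsBlock c m (M m))
    (rows : Fin 45 ≃ Mon 8) (cols : Fin 45 ≃ Col) :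
    (sylvester c M rows cols).det = aeval c (genericDet rows cols) := by
  have h1 := fun m => (isBlock_standardBlock (fun u => (X u : MvPolynomial (Mon 6) ℤ)) m).map
    (aeval c : MvPolynomial (Mon 6) ℤ →ₐ[ℤ] R).toRingHom
  have hc : (fun u => (aeval c : MvPolynomial (Mon 6) ℤ →ₐ[ℤ] R).toRingHom (X u)) = c := by
    funext u
    simp
  have h2 := sylvester_map (aeval c : MvPolynomial (Mon 6) ℤ →ₐ[ℤ] R).toRingHom
    (fun u => (X u : MvPolynomial (Mon 6) ℤ)) (standardBlock fun u => X u) rows cols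
  rw [hc] at h1 h2
  rw [det_sylvester_eq h1 h rows cols, h2, genericDet]
  exact ((aeval c : MvPolynomial (Mon 6) ℤ →ₐ[ℤ] R).toRingHom.map_det _).symm

/-! ### Divisibility by a power of six -/

/-- If `f = M v` for powers `v` of the variables and `∑ X i * f i = 0`, then `det M` lies in the
ideal generated by the `f i`. -/
theorem exists_det_eq_sum_of_euler {R : Type*} [CommRing R] (a : Fin 3 → ℕ)
    (M : Matrix (Fin 3) (Fin 3) (MvPolynomial (Fin 3) R)) (f : Fin 3 → MvPolynomial (Fin 3) R)
    (hM : f = M *ᵥ fun i => X i ^ a i) (hE : ∑ i, X i * f i = 0) :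
    ∃ n : Fin 3 → MvPolynomial (Fin 3) R, M.det = ∑ i, n i * f i := by
  set v : Fin 3 → MvPolynomial (Fin 3) R := fun i => X i ^ a i with hv
  have e : ∀ i, f i = M i 0 * v 0 + M i 1 * v 1 + M i 2 * v 2 := fun i => by
    rw [hM, mulVec, dotProduct, Fin.sum_univ_three]
  rw [Fin.sum_univ_three] at hE
  -- by Euler's relation the combination of the rows with coefficients `X i` is a syzygy
  obtain ⟨w, hw⟩ := exists_eq_cross_of_sum_mul_X_pow_eq_zero a
    (fun k => X 0 * M 0 k + X 1 * M 1 k + X 2 * M 2 k) (by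
      rw [Fin.sum_univ_three]
      simp only [e] at hE
      linear_combination hE)
  have w0 := congrFun hw 0
  have w1 := congrFun hw 1
  have w2 := congrFun hw 2
  simp [cross_apply] at w0 w1 w2
  -- the combination is `w ⨯₃ v`, so the products of the rows with `w` are a syzygy of the variables
  obtain ⟨n, hn⟩ := exists_eq_cross_of_sum_mul_X_pow_eq_zero (fun _ => 1)
    (fun i => w 0 * M i 0 + w 1 * M i 1 + w 2 * M i 2) (by
      rw [Fin.sum_univ_three]
      simp only [pow_one]
      linear_combination w 0 * w0 + w 1 * w1 + w 2 * w2)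
  have n1 := congrFun hn 1
  have n2 := congrFun hn 2
  simp [cross_apply] at n1 n2
  refine ⟨n, ?_⟩
  have hreg : IsLeftRegular (X 0 : MvPolynomial (Fin 3) R) := by
    intro s t hst
    ext m
    have := congrArg (coeff (Finsupp.single 0 1 + m)) hst
    simpa using this
  refine hreg ?_
  change X 0 * M.det = X 0 * ∑ i, n i * f i
  rw [det_fin_three, Fin.sum_univ_three]
  simp only [e] at hE ⊢
  simp only [hv] at hE ⊢
  linear_combination (M 1 1 * M 2 2 - M 1 2 * M 2 1) * w0 + (M 1 2 * M 2 0 - M 1 0 * M 2 2) * w1 +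
    (M 1 0 * M 2 1 - M 1 1 * M 2 0) * w2 +
    (M 2 0 * X 0 ^ a 0 + M 2 1 * X 1 ^ a 1 + M 2 2 * X 2 ^ a 2) * n1 -
    (M 1 0 * X 0 ^ a 0 + M 1 1 * X 1 ^ a 1 + M 1 2 * X 2 ^ a 2) * n2 - n 0 * hE

/-- If the columns `t i` become divisible by `a` upon adding combinations of columns of lower
level, then a power of `a` divides the determinant. -/
theorem pow_card_dvd_det {n ι A : Type*} [Fintype n] [DecidableEq n] [Fintype ι] [CommRing A]
    (S : Matrix n n A) (a : A) (t : ι → n) (ht : Function.Injective t) (level : n → ℕ)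
    (h : ∀ i, ∃ u : n → A, u (t i) = 1 ∧ (∀ k, u k ≠ 0 → k = t i ∨ level k < level (t i)) ∧
      ∀ r, a ∣ (S *ᵥ u) r) : a ^ Fintype.card ι ∣ S.det := by
  classical
  choose u hu1 hu2 hu3 using h
  choose q hq using hu3
  let U : Matrix n n A := of fun k j => if hj : ∃ i, t i = j then u hj.choose k else
    if k = j then 1 else 0
  let B : Matrix n n A := of fun r j => if hj : ∃ i, t i = j then q hj.choose r else S r j
  have hU : U.det = 1 := by
    rw [det_eq_prod_diag_of_level U level]
    · refine Finset.prod_eq_one fun j _ => ?_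
      simp only [U, of_apply]
      split_ifs with hj
      · exact (congrArg (u hj.choose) hj.choose_spec.symm).trans (hu1 _)
      · rfl
    · intro k j hkj
      simp only [U, of_apply] at hkj
      split_ifs at hkj with hj hk
      · have := hu2 _ _ hkj
        rwa [hj.choose_spec] at this
      · exact Or.inl hk
      · exact absurd rfl hkj
  have hSU : S * U = of fun r j => (if ∃ i, t i = j then a else 1) * B r j := by
    ext r j
    simp only [of_apply, B, U, mul_apply]
    split_ifs with hj
    · exact hq hj.choose r
    · simp
  have := congrArg Matrix.det hSU
  rw [det_mul, hU, mul_one, det_mul_row] at this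
  rw [this]
  refine Dvd.dvd.mul_right ?_ _
  rw [Finset.prod_ite, Finset.prod_const, Finset.prod_const_one, mul_one]
  have hc : (Finset.univ.filter fun j => ∃ i, t i = j) = Finset.univ.image t := by
    ext j
    simp
  rw [hc, Finset.card_image_of_injective _ ht, Finset.card_univ]

theorem euler_sextic {R : Type*} [CommRing R] (c : Mon 6 → R) :
    ∑ i, X i * pderiv i (sextic c) = 6 * sextic c := by
  have := (isHomogeneous_sextic c).sum_X_mul_pderiv
  simpa using this

/-- The Sylvester determinant is divisible by `6 ^ 21`: column operations make `21` columns
divisible by `6`. For a quadratic monomial `q` the column of `x q ∂f/∂x` turns by Euler's relation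
into the column of `6 q f`; modulo `6` Euler's relation also makes `det M_rst` a combination of the
first `30` columns. -/
theorem six_pow_dvd_det_sylvester {R : Type*} [CommRing R] {c : Mon 6 → R}
    {M : Mon 4 → Matrix (Fin 3) (Fin 3) (MvPolynomial (Fin 3) R)} (h : ∀ m, IsBlock c m (M m))
    (rows : Fin 45 ≃ Mon 8) (cols : Fin 45 ≃ Col) :
    6 ^ 21 ∣ (sylvester c M rows cols).det := by
  let S : Matrix Col Col R := (octicMatrix c M).submatrix (cols.symm.trans rows) id
  have hS : sylvester c M rows cols = S.submatrix cols cols := by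
    ext a b
    simp [S, sylvester, octicMatrix]
  rw [hS, det_submatrix_equiv_self]
  let mul_X (i : Fin 3) (p : Mon 2) : Mon 3 := ⟨p.1 + Finsupp.single i 1, by
    rw [mem_mon_iff, map_add, Finsupp.degree_single, mon_degree]⟩
  let t : Mon 2 ⊕ Mon 4 → Col := Sum.map (fun p => (0, mul_X 0 p)) id
  let level : Col → ℕ := Sum.elim (fun x => if x.1 = 0 then 1 else 0) fun _ => 2
  have hcard : Fintype.card (Mon 2 ⊕ Mon 4) = 21 := by
    rw [Fintype.card_sum, card_mon_two, card_mon_four]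
  rw [← hcard]
  refine pow_card_dvd_det S 6 t ?_ level ?_
  · refine Function.Injective.sumMap ?_ Function.injective_id
    intro p q hpq
    exact Subtype.ext (add_right_cancel (congrArg Subtype.val (congrArg Prod.snd hpq)))
  · rintro (p | m)
    · refine ⟨Sum.elim (fun x => if x.2 = mul_X x.1 p then 1 else 0) 0, by simp [t], ?_, ?_⟩
      · rintro (⟨i, q⟩ | m) hk
        · by_cases hi : i = 0
          · left
            subst hi
            simp only [Sum.elim_inl, ne_eq, ite_eq_right_iff, not_forall] at hk
            simp [t, hk.choose]
          · right
            simp [level, t, hi]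
        · simp at hk
      · intro r
        refine ⟨coeff (rows (cols.symm r)).1 (monomial p.1 1 * sextic c), ?_⟩
        have e : monomial p.1 1 * ∑ i, X i * pderiv i (sextic c) =
            monomial p.1 1 * (6 * sextic c) := by rw [euler_sextic]
        have e2 : (6 : R) * coeff (rows (cols.symm r)).1 (monomial p.1 1 * sextic c) =
            coeff (rows (cols.symm r)).1 (monomial p.1 1 * (6 * sextic c)) := by
          rw [← coeff_C_mul]
          congr 1
          rw [show (C 6 : MvPolynomial (Fin 3) R) = 6 from map_ofNat C 6]
          ring
        rw [e2, ← e, Finset.mul_sum, coeff_sum]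
        simp only [mulVec, dotProduct, Fintype.sum_sum_type, Fintype.sum_prod_type, S,
          octicMatrix, submatrix_apply, of_apply, octic, id, Sum.elim_inl, Sum.elim_inr,
          Pi.zero_apply, mul_zero, Finset.sum_const_zero, add_zero, mul_ite, mul_one]
        refine Finset.sum_congr rfl fun i _ => ?_
        rw [Finset.sum_eq_single (mul_X i p) (fun q _ hq => if_neg hq) (by simp), if_pos rfl]
        rw [← mul_assoc, X, monomial_mul, mul_one]
        rfl
    · -- reduction of the coefficients modulo `6`
      let π := Ideal.Quotient.mk (Ideal.span {(6 : R)})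
      have h6 : (6 : R ⧸ Ideal.span {(6 : R)}) = 0 := by
        have : π 6 = 0 := Ideal.Quotient.eq_zero_iff_mem.2 (Ideal.mem_span_singleton_self _)
        rwa [map_ofNat] at this
      have hb := (h m).map π
      obtain ⟨n, hn⟩ := exists_det_eq_sum_of_euler (fun k => m.1 k + 1) _ _ hb.identity (by
        rw [euler_sextic, show (6 : MvPolynomial (Fin 3) (R ⧸ Ideal.span {(6 : R)})) = C 6 from
          (map_ofNat C 6).symm, h6, C_0, zero_mul])
      obtain ⟨k, hk⟩ := exists_coeffs_of_isHomogeneous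
        (f := fun i => pderiv i (sextic fun u => π (c u)))
        hb.isHomogeneous_det (fun i => isHomogeneous_pderiv_sextic _ i) hn
      choose k' hk' using fun x => Ideal.Quotient.mk_surjective (I := Ideal.span {(6 : R)}) (k x)
      refine ⟨Sum.elim (fun x => - k' x) (Pi.single m 1), by simp [t], ?_, ?_⟩
      · rintro (⟨i, q⟩ | m') hk
        · right
          simp only [level, t, Sum.map_inr, Sum.elim_inl, Sum.elim_inr]
          split_ifs <;> omega
        · left
          by_contra hne
          refine hk ?_
          simp only [Sum.elim_inr]
          exact Pi.single_eq_of_ne (fun e => hne (by rw [e]; rfl)) _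
      · intro r
        rw [← Ideal.mem_span_singleton, ← Ideal.Quotient.eq_zero_iff_mem]
        have hk2 := congrArg (coeff (rows (cols.symm r)).1) hk
        have hdet : ((M m).map (MvPolynomial.map π)).det = MvPolynomial.map π (M m).det := by
          rw [RingHom.map_det, RingHom.mapMatrix_apply]
        rw [hdet, coeff_map, coeff_sum] at hk2
        simp only [mulVec, dotProduct, Fintype.sum_sum_type, S,
          octicMatrix, submatrix_apply, of_apply, octic, id, Sum.elim_inl, Sum.elim_inr]
        change π _ = 0
        rw [map_add, map_sum]
        have hs : ∑ x : Mon 4, coeff (rows (cols.symm r)).1 (M x).det *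
            Pi.single (M := fun _ => R) m 1 x =
            coeff (rows (cols.symm r)).1 (M m).det := by
          simp [Pi.single_apply]
        simp only [Equiv.trans_apply]
        rw [hs, hk2, ← Finset.sum_add_distrib]
        refine Finset.sum_eq_zero fun x _ => ?_
        rw [coeff_C_mul, ← hk', sextic_map, pderiv_map, map_mul, map_neg, ← coeff_map,
          _root_.map_mul (MvPolynomial.map π), map_monomial, π.map_one]
        ring

/-! ### The Sylvester determinant of Fermat and chain sextics -/

/-- The exponent vector of `x ^ a * y ^ b * z ^ c`. -/
def expo (a b c : ℕ) : Fin 3 →₀ ℕ :=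
  Finsupp.single 0 a + Finsupp.single 1 b + Finsupp.single 2 c

@[simp] theorem expo_zero (a b c : ℕ) : expo a b c 0 = a := by simp [expo]
@[simp] theorem expo_one (a b c : ℕ) : expo a b c 1 = b := by simp [expo]
@[simp] theorem expo_two (a b c : ℕ) : expo a b c 2 = c := by simp [expo]

theorem degree_expo (a b c : ℕ) : (expo a b c).degree = a + b + c := by
  simp [expo]

theorem monomial_expo {R : Type*} [CommRing R] (a b c : ℕ) (r : R) :
    monomial (expo a b c) r = C r * (X 0 ^ a * X 1 ^ b * X 2 ^ c) := by
  simp [expo, X_pow_eq_monomial, monomial_mul, C_mul_monomial]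

theorem mon_ext {d : ℕ} {m m' : Mon d} (h0 : m.1 0 = m'.1 0) (h1 : m.1 1 = m'.1 1) : m = m' := by
  have := mon_sum m
  have := mon_sum m'
  refine Subtype.ext (Finsupp.ext fun i => ?_)
  fin_cases i
  · exact h0
  · exact h1
  · change m.1 2 = m'.1 2
    omega

/-- A product over the monomials of degree `d` as an iterated product over the exponents of `x`
and `y`. -/
theorem prod_mon {R : Type*} [CommMonoid R] (d : ℕ) (g : ℕ → ℕ → ℕ → R) :
    ∏ m : Mon d, g (m.1 0) (m.1 1) (m.1 2) =
      ∏ a ∈ Finset.range (d + 1), ∏ b ∈ Finset.range (d + 1 - a), g a b (d - a - b) := by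
  rw [Finset.prod_sigma']
  refine Finset.prod_bij' (fun m _ => ⟨m.1 0, m.1 1⟩)
    (fun x hx => ⟨expo x.1 x.2 (d - x.1 - x.2), by
      rw [Finset.mem_sigma, Finset.mem_range, Finset.mem_range] at hx
      rw [mem_mon_iff, degree_expo]
      omega⟩) ?_ ?_ ?_ ?_ ?_
  · intro m _
    have := mon_sum m
    simp only [Finset.mem_sigma, Finset.mem_range]
    omega
  · simp
  · intro m _
    exact mon_ext (by simp) (by simp)
  · intro x _
    simp
  · intro m _
    have := mon_sum m
    change _ = g (m.1 0) (m.1 1) (d - m.1 0 - m.1 1)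
    congr 1
    omega

/-- If every octic has at most two terms, one of them a pivot, the pivots of the columns being
distinct and the other terms of lower level, then the Sylvester determinant is up to sign the
product of the pivot coefficients. -/
theorem det_sylvester_of_pivots {R : Type*} [CommRing R] {c : Mon 6 → R}
    {M : Mon 4 → Matrix (Fin 3) (Fin 3) (MvPolynomial (Fin 3) R)}
    (piv oth : Col → Fin 3 →₀ ℕ) (p o : Col → R) (level : (Fin 3 →₀ ℕ) → ℕ)
    (h : ∀ j, octic c M j = monomial (piv j) (p j) + monomial (oth j) (o j))
    (hdeg : ∀ j, (piv j).degree = 8) (hinj : Function.Injective piv)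
    (hlevel : ∀ j, o j = 0 ∨ level (oth j) < level (piv j))
    (rows : Fin 45 ≃ Mon 8) (cols : Fin 45 ≃ Col) :
    ∃ ε : ℤˣ, (sylvester c M rows cols).det = ((ε : ℤ) : R) * ∏ j, p j := by
  let π : Col → Mon 8 := fun j => ⟨piv j, (mem_mon_iff _).2 (hdeg j)⟩
  have hπ : Function.Bijective π := by
    rw [Fintype.bijective_iff_injective_and_card, card_col, card_mon_eight]
    exact ⟨fun i j hij => hinj (congrArg Subtype.val hij), rfl⟩
  let e : Col ≃ Mon 8 := Equiv.ofBijective π hπ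
  let B : Matrix Col Col R := (octicMatrix c M).submatrix e id
  have hne : ∀ j, o j = 0 ∨ oth j ≠ piv j := fun j => by
    rcases hlevel j with h0 | h0
    · exact Or.inl h0
    · exact Or.inr fun h1 => absurd h0 (by rw [h1]; exact lt_irrefl _)
  have hB : B.det = ∏ j, p j := by
    rw [det_eq_prod_diag_of_level B fun j => level (piv j)]
    · refine Finset.prod_congr rfl fun j _ => ?_
      change coeff (piv j) (octic c M j) = p j
      rw [h, coeff_add, coeff_monomial, if_pos rfl, coeff_monomial]
      rcases hne j with h0 | h0
      · simp [h0]
      · simp [h0]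
    · intro i j hij
      change coeff (piv i) (octic c M j) ≠ 0 at hij
      rw [h, coeff_add, coeff_monomial, coeff_monomial] at hij
      by_cases hp : piv j = piv i
      · exact Or.inl (hinj hp.symm)
      · rw [if_neg hp, zero_add] at hij
        split_ifs at hij with hq
        · right
          rw [← hq]
          exact (hlevel j).resolve_left hij
        · exact absurd rfl hij
  refine ⟨Equiv.Perm.sign ((rows.trans e.symm).trans cols.symm), ?_⟩
  have hS : sylvester c M rows cols =
      (B.submatrix cols cols).submatrix ((rows.trans e.symm).trans cols.symm) id := by
    ext a b
    simp [B, sylvester, octicMatrix]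
  rw [hS, det_permute, det_submatrix_equiv_self, hB]

/-- The coefficients of a ternary sextic. -/
def coeffs {R : Type*} [CommRing R] (F : MvPolynomial (Fin 3) R) : Mon 6 → R :=
  fun m => coeff m.1 F

theorem sextic_coeffs {R : Type*} [CommRing R] {F : MvPolynomial (Fin 3) R}
    (hF : F.IsHomogeneous 6) : sextic (coeffs F) = F :=
  sum_monomial_coeff hF

theorem isHomogeneous_monomial_expo {R : Type*} [CommRing R] (r : R) {a b c n : ℕ}
    (h : a + b + c = n) : (monomial (expo a b c) r).IsHomogeneous n :=
  isHomogeneous_monomial _ (by rw [degree_expo, h])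

theorem expo_sub_single_zero (a b c n : ℕ) :
    expo a b c - Finsupp.single 0 n = expo (a - n) b c := by
  ext i
  fin_cases i <;> simp

theorem expo_sub_single_one (a b c n : ℕ) :
    expo a b c - Finsupp.single 1 n = expo a (b - n) c := by
  ext i
  fin_cases i <;> simp

theorem expo_sub_single_two (a b c n : ℕ) :
    expo a b c - Finsupp.single 2 n = expo a b (c - n) := by
  ext i
  fin_cases i <;> simp

theorem monomial_mul_expo {R : Type*} [CommRing R] {d : ℕ} (m : Mon d) (a b c : ℕ) (r : R) :
    monomial m.1 1 * monomial (expo a b c) r =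
      monomial (expo (m.1 0 + a) (m.1 1 + b) (m.1 2 + c)) r := by
  rw [monomial_mul, one_mul]
  have : m.1 + expo a b c = expo (m.1 0 + a) (m.1 1 + b) (m.1 2 + c) := by
    ext i
    fin_cases i <;> simp
  rw [this]

/-- The Sylvester determinant of `a x⁶ + y⁶ + z⁶`: with diagonal blocks all octics are single
terms. -/
theorem aeval_fermat_genericDet (a : ℤ) (rows : Fin 45 ≃ Mon 8) (cols : Fin 45 ≃ Col) :
    ∃ c : Mon 6 → ℤ, ∃ ε : ℤˣ, aeval c (genericDet rows cols) = ε * (6 ^ 75 * a ^ 25) := by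
  let F : MvPolynomial (Fin 3) ℤ :=
    monomial (expo 6 0 0) a + monomial (expo 0 6 0) 1 + monomial (expo 0 0 6) 1
  let c := coeffs F
  have hF : sextic c = F := sextic_coeffs (by
    refine IsHomogeneous.add (IsHomogeneous.add ?_ ?_) ?_ <;>
      exact isHomogeneous_monomial_expo _ (by norm_num))
  have h0 : pderiv 0 F = monomial (expo 5 0 0) (6 * a) := by
    simp [F, pderiv_monomial, expo_sub_single_zero, mul_comm]
  have h1 : pderiv 1 F = monomial (expo 0 5 0) 6 := by
    simp [F, pderiv_monomial, expo_sub_single_one]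
  have h2 : pderiv 2 F = monomial (expo 0 0 5) 6 := by
    simp [F, pderiv_monomial, expo_sub_single_two]
  let M : Mon 4 → Matrix (Fin 3) (Fin 3) (MvPolynomial (Fin 3) ℤ) := fun m =>
    diagonal ![monomial (expo (4 - m.1 0) 0 0) (6 * a), monomial (expo 0 (4 - m.1 1) 0) 6,
      monomial (expo 0 0 (4 - m.1 2)) 6]
  have hM : ∀ m, IsBlock c m (M m) := by
    intro m
    have l0 := mon_le m 0
    have l1 := mon_le m 1
    have l2 := mon_le m 2
    constructor
    · intro i k
      by_cases hik : i = k
      · subst hik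
        fin_cases i <;> simp [M] <;> exact isHomogeneous_monomial_expo _ (by simp)
      · simp only [M]
        rw [diagonal_apply_ne _ hik]
        exact isHomogeneous_zero _ _ _
    · funext i
      rw [hF, mulVec_diagonal]
      fin_cases i
      · simp only [Fin.zero_eta, Matrix.cons_val, h0, monomial_expo]
        rw [show 5 = 4 - m.1 0 + (m.1 0 + 1) by omega, pow_add]
        ring
      · simp only [Fin.mk_one, Matrix.cons_val, h1, monomial_expo]
        rw [show 5 = 4 - m.1 1 + (m.1 1 + 1) by omega, pow_add]
        ring
      · simp only [Fin.reduceFinMk, Matrix.cons_val, h2, monomial_expo]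
        rw [show 5 = 4 - m.1 2 + (m.1 2 + 1) by omega, pow_add]
        ring
  let piv : Col → Fin 3 →₀ ℕ
    | Sum.inl (i, q) => ![expo (q.1 0 + 5) (q.1 1) (q.1 2), expo (q.1 0) (q.1 1 + 5) (q.1 2),
        expo (q.1 0) (q.1 1) (q.1 2 + 5)] i
    | Sum.inr m => expo (4 - m.1 0) (4 - m.1 1) (4 - m.1 2)
  let p : Col → ℤ
    | Sum.inl (i, _) => ![6 * a, 6, 6] i
    | Sum.inr _ => 216 * a
  obtain ⟨ε, hε⟩ := det_sylvester_of_pivots (c := c) (M := M) piv piv p 0 0 (by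
    rintro (⟨i, q⟩ | m)
    · simp only [octic, hF, Pi.zero_apply, map_zero, add_zero]
      fin_cases i
      · simp only [Fin.zero_eta, h0, monomial_mul_expo, piv, p, Matrix.cons_val, add_zero]
      · simp only [Fin.mk_one, h1, monomial_mul_expo, piv, p, Matrix.cons_val, add_zero]
      · simp only [Fin.reduceFinMk, h2, monomial_mul_expo, piv, p, Matrix.cons_val, add_zero]
    · simp only [octic, Pi.zero_apply, map_zero, add_zero, M, det_diagonal, piv, p]
      rw [Fin.prod_univ_three]
      simp [monomial_expo]
      ring) (by
    rintro (⟨i, q⟩ | m)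
    · have := mon_sum q
      fin_cases i <;> simp [piv, degree_expo] <;> omega
    · have := mon_sum m
      simp only [piv, degree_expo]
      omega) (by
    rintro (⟨i, q⟩ | m) (⟨i', q'⟩ | m') h
    · have e0 := DFunLike.congr_fun h 0
      have e1 := DFunLike.congr_fun h 1
      have e2 := DFunLike.congr_fun h 2
      have := mon_sum q
      have := mon_sum q'
      fin_cases i <;> fin_cases i' <;> simp [piv] at e0 e1 e2 <;>
        first
        | (exfalso; omega)
        | (rw [mon_ext (m := q) (m' := q') (by omega) (by omega)])
    · have e0 := DFunLike.congr_fun h 0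
      have e1 := DFunLike.congr_fun h 1
      have e2 := DFunLike.congr_fun h 2
      have := mon_sum m'
      fin_cases i <;> simp [piv] at e0 e1 e2 <;> omega
    · have e0 := DFunLike.congr_fun h 0
      have e1 := DFunLike.congr_fun h 1
      have e2 := DFunLike.congr_fun h 2
      have := mon_sum m
      fin_cases i' <;> simp [piv] at e0 e1 e2 <;> omega
    · have e0 := DFunLike.congr_fun h 0
      have e1 := DFunLike.congr_fun h 1
      have := mon_sum m
      have := mon_sum m'
      simp [piv] at e0 e1
      rw [mon_ext (m := m) (m' := m') (by omega) (by omega)]) (fun _ => Or.inl rfl) rows cols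
  refine ⟨c, ε, ?_⟩
  rw [← det_sylvester_eq_aeval_genericDet hM, hε, Fintype.prod_sum_type, Fintype.prod_prod_type,
    Fin.prod_univ_three]
  simp only [p, Finset.prod_const, Finset.card_univ, card_mon_three, card_mon_four, Matrix.cons_val]
  simp only [Int.cast_id]
  ring

/-- Blocks of the sextic `x⁵y + y⁵z + d z⁶`, whose partial derivatives are `5x⁴y`, `x⁵ + 5y⁴z` and
`y⁵ + 6d z⁵`. For the exponents `(4, 0, 0)` and `(0, 4, 0)` the term `5x⁴y` or `5y⁴z` is not
divisible by `x⁵` or `y⁵`, and is assigned to the other variable. -/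
def chainBlock (d : ℤ) (m : Mon 4) : Matrix (Fin 3) (Fin 3) (MvPolynomial (Fin 3) ℤ) :=
  if m.1 0 = 4 then
    !![0, monomial (expo 4 0 0) 5, 0;
      monomial (expo 0 0 0) 1, monomial (expo 0 3 1) 5, 0;
      0, monomial (expo 0 4 0) 1, monomial (expo 0 0 4) (6 * d)]
  else if m.1 1 = 4 then
    !![monomial (expo 3 1 0) 5, 0, 0;
      monomial (expo 4 0 0) 1, 0, monomial (expo 0 4 0) 5;
      0, monomial (expo 0 0 0) 1, monomial (expo 0 0 4) (6 * d)]
  else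
    !![monomial (expo (3 - m.1 0) 1 0) 5, 0, 0;
      monomial (expo (4 - m.1 0) 0 0) 1, monomial (expo 0 (3 - m.1 1) 1) 5, 0;
      0, monomial (expo 0 (4 - m.1 1) 0) 1, monomial (expo 0 0 (4 - m.1 2)) (6 * d)]

theorem isBlock_chainBlock {d : ℤ} {c : Mon 6 → ℤ}
    (h0 : pderiv 0 (sextic c) = monomial (expo 4 1 0) 5)
    (h1 : pderiv 1 (sextic c) = monomial (expo 5 0 0) 1 + monomial (expo 0 4 1) 5)
    (h2 : pderiv 2 (sextic c) = monomial (expo 0 5 0) 1 + monomial (expo 0 0 5) (6 * d))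
    (m : Mon 4) : IsBlock c m (chainBlock d m) := by
  have l0 := mon_le m 0
  have l1 := mon_le m 1
  have l2 := mon_le m 2
  have hm := mon_sum m
  constructor
  · intro i k
    unfold chainBlock
    split_ifs with e0 e1
    · have e1 : m.1 1 = 0 := by omega
      have e2 : m.1 2 = 0 := by omega
      fin_cases i <;> fin_cases k <;> simp [e0, e1, e2] <;>
        first
        | exact isHomogeneous_zero _ _ _
        | exact isHomogeneous_monomial_expo _ (by norm_num)
    · have e0 : m.1 0 = 0 := by omega
      have e2 : m.1 2 = 0 := by omega
      fin_cases i <;> fin_cases k <;> simp [e0, e1, e2] <;>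
        first
        | exact isHomogeneous_zero _ _ _
        | exact isHomogeneous_monomial_expo _ (by norm_num)
    · fin_cases i <;> fin_cases k <;> simp <;>
        first
        | exact isHomogeneous_zero _ _ _
        | exact isHomogeneous_monomial_expo _ (by omega)
  · unfold chainBlock
    split_ifs with e0 e1
    · have e1 : m.1 1 = 0 := by omega
      have e2 : m.1 2 = 0 := by omega
      funext i
      fin_cases i
      · simp [mulVec, dotProduct, Fin.sum_univ_three, h0, e0, e1, e2, monomial_expo]
        ring
      · simp [mulVec, dotProduct, Fin.sum_univ_three, h1, e0, e1, e2, monomial_expo]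
        ring
      · simp [mulVec, dotProduct, Fin.sum_univ_three, h2, e0, e1, e2, monomial_expo]
        ring
    · have e0 : m.1 0 = 0 := by omega
      have e2 : m.1 2 = 0 := by omega
      funext i
      fin_cases i
      · simp [mulVec, dotProduct, Fin.sum_univ_three, h0, e0, e1, e2, monomial_expo]
        ring
      · simp [mulVec, dotProduct, Fin.sum_univ_three, h1, e0, e1, e2, monomial_expo]
        try ring
      · simp [mulVec, dotProduct, Fin.sum_univ_three, h2, e0, e1, e2, monomial_expo]
        ring
    · have hp : ∀ (i : Fin 3) {a b n : ℕ}, a + b = n →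
          (X i ^ a * X i ^ b : MvPolynomial (Fin 3) ℤ) = X i ^ n := fun i a b n hab => by
        rw [← pow_add, hab]
      funext i
      fin_cases i
      · simp [mulVec, dotProduct, Fin.sum_univ_three, h0, monomial_expo]
        linear_combination -5 * X 1 * hp 0 (show 3 - m.1 0 + (m.1 0 + 1) = 4 by omega)
      · simp [mulVec, dotProduct, Fin.sum_univ_three, h1, monomial_expo]
        linear_combination -hp 0 (show 4 - m.1 0 + (m.1 0 + 1) = 5 by omega)
          -5 * X 2 * hp 1 (show 3 - m.1 1 + (m.1 1 + 1) = 4 by omega)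
      · simp [mulVec, dotProduct, Fin.sum_univ_three, h2, monomial_expo]
        linear_combination -hp 1 (show 4 - m.1 1 + (m.1 1 + 1) = 5 by omega)
          -6 * (d : MvPolynomial (Fin 3) ℤ) * hp 2 (show 4 - m.1 2 + (m.1 2 + 1) = 5 by omega)

/-- The pivots of the columns for the sextic `x⁵y + y⁵z + d z⁶`: a choice of one monomial in every
octic such that no monomial is chosen twice. -/
def chainPivot : Col → Fin 3 →₀ ℕ
  | Sum.inl (i, q) => ![expo (q.1 0 + 4) (q.1 1 + 1) (q.1 2),
      if q.1 1 = 0 then expo (q.1 0 + 5) (q.1 1) (q.1 2) else expo (q.1 0) (q.1 1 + 4) (q.1 2 + 1),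
      if q.1 2 = 0 ∧ q.1 1 ≠ 0 then expo (q.1 0) (q.1 1 + 5) (q.1 2)
        else expo (q.1 0) (q.1 1) (q.1 2 + 5)] i
  | Sum.inr m => if m.1 0 = 4 then expo 4 0 4 else if m.1 1 = 4 then expo 3 5 0 else
      expo (3 - m.1 0) (4 - m.1 1) (5 - m.1 2)

/-- The coefficients of the pivots. -/
def chainPivotCoeff (d : ℤ) : Col → ℤ
  | Sum.inl (i, q) => ![5, if q.1 1 = 0 then 1 else 5,
      if q.1 2 = 0 ∧ q.1 1 ≠ 0 then 1 else 6 * d] i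
  | Sum.inr m => if m.1 0 = 4 then -30 * d else if m.1 1 = 4 then -25 else 150 * d

/-- The monomials of the columns other than the pivots; where there is none, the value is `0` and
the coefficient given by `chainOtherCoeff` vanishes. -/
def chainOther : Col → Fin 3 →₀ ℕ
  | Sum.inl (i, q) => ![0,
      if q.1 1 = 0 then expo (q.1 0) (q.1 1 + 4) (q.1 2 + 1) else expo (q.1 0 + 5) (q.1 1) (q.1 2),
      if q.1 2 = 0 ∧ q.1 1 ≠ 0 then expo (q.1 0) (q.1 1) (q.1 2 + 5)
        else expo (q.1 0) (q.1 1 + 5) (q.1 2)] i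
  | Sum.inr _ => 0

/-- The coefficients of the second monomials. -/
def chainOtherCoeff (d : ℤ) : Col → ℤ
  | Sum.inl (i, q) => ![0, if q.1 1 = 0 then 5 else 1,
      if q.1 2 = 0 ∧ q.1 1 ≠ 0 then 6 * d else 1] i
  | Sum.inr _ => 0

/-- A level on octic monomials that is larger at the pivot of a column than at its other term. -/
def chainLevel (s : Fin 3 →₀ ℕ) : ℕ :=
  if 6 ≤ s 2 then 2
  else if (s 1 = 0 ∧ 5 ≤ s 0) ∨ (5 ≤ s 1 ∧ 1 ≤ s 2 ∧ s 0 ≤ 2) ∨ (s 2 = 0 ∧ s 0 ≤ 2) ∨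
    (s 0 = 3 ∧ s 1 = 0 ∧ s 2 = 5) then 1 else 0

theorem chainPivot_degree (j : Col) : (chainPivot j).degree = 8 := by
  rcases j with ⟨i, q⟩ | m
  · have := mon_sum q
    fin_cases i <;> simp [chainPivot] <;> (try split_ifs) <;> rw [degree_expo] <;> omega
  · have := mon_sum m
    simp only [chainPivot, apply_ite Finsupp.degree, degree_expo]
    split_ifs <;> omega

theorem chainLevel_expo_eq_two {a b c : ℕ} (h : 6 ≤ c) : chainLevel (expo a b c) = 2 := by
  simp [chainLevel, h]

theorem chainLevel_expo_lt_two {a b c : ℕ} (h : c < 6) : chainLevel (expo a b c) < 2 := by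
  simp only [chainLevel, expo_zero, expo_one, expo_two, not_le.2 h, if_false]
  split_ifs <;> norm_num

theorem chainLevel_expo_eq_one {a b c : ℕ} (h : c < 6)
    (h' : (b = 0 ∧ 5 ≤ a) ∨ (5 ≤ b ∧ 1 ≤ c ∧ a ≤ 2) ∨ (c = 0 ∧ a ≤ 2) ∨
      (a = 3 ∧ b = 0 ∧ c = 5)) : chainLevel (expo a b c) = 1 := by
  simp only [chainLevel, expo_zero, expo_one, expo_two, not_le.2 h, if_false, h', if_true]

theorem chainLevel_expo_eq_zero {a b c : ℕ} (h : c < 6)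
    (h' : ¬ ((b = 0 ∧ 5 ≤ a) ∨ (5 ≤ b ∧ 1 ≤ c ∧ a ≤ 2) ∨ (c = 0 ∧ a ≤ 2) ∨
      (a = 3 ∧ b = 0 ∧ c = 5))) : chainLevel (expo a b c) = 0 := by
  simp only [chainLevel, expo_zero, expo_one, expo_two, not_le.2 h, if_false, h']

theorem chainLevel_lt (d : ℤ) (j : Col) :
    chainOtherCoeff d j = 0 ∨ chainLevel (chainOther j) < chainLevel (chainPivot j) := by
  rcases j with ⟨i, q⟩ | m
  · have := mon_sum q
    fin_cases i
    · left
      rfl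
    · right
      simp only [chainOther, chainPivot, Fin.mk_one, Matrix.cons_val]
      split_ifs with hq
      · rw [chainLevel_expo_eq_zero, chainLevel_expo_eq_one] <;> omega
      · rw [chainLevel_expo_eq_zero, chainLevel_expo_eq_one] <;> omega
    · right
      simp only [chainOther, chainPivot, Fin.reduceFinMk, Matrix.cons_val]
      split_ifs with hq
      · rw [chainLevel_expo_eq_zero, chainLevel_expo_eq_one] <;> omega
      · by_cases hz : q.1 2 = 0
        · rw [chainLevel_expo_eq_zero, chainLevel_expo_eq_one] <;> omega
        · rw [chainLevel_expo_eq_two (c := q.1 2 + 5) (by omega)]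
          exact chainLevel_expo_lt_two (by omega)
  · left
    rfl

theorem expo_inj {a b c a' b' c' : ℕ} (h : expo a b c = expo a' b' c') :
    a = a' ∧ b = b' ∧ c = c' :=
  ⟨by simpa using DFunLike.congr_fun h 0, by simpa using DFunLike.congr_fun h 1,
    by simpa using DFunLike.congr_fun h 2⟩

theorem chainPivot_injective : Function.Injective chainPivot := by
  rintro (⟨i, q⟩ | m) (⟨i', q'⟩ | m') h
  · have := mon_sum q
    have := mon_sum q'
    fin_cases i <;> fin_cases i' <;> simp [chainPivot] at h <;> (try split_ifs at h) <;>
      have e := expo_inj h <;>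
      first
      | (exfalso; omega)
      | (rw [mon_ext (m := q) (m' := q') (by omega) (by omega)])
  · have := mon_sum q
    have := mon_sum m'
    fin_cases i <;> simp [chainPivot] at h <;> (try split_ifs at h) <;>
      have e := expo_inj h <;> omega
  · have := mon_sum q'
    have := mon_sum m
    fin_cases i' <;> simp [chainPivot] at h <;> (try split_ifs at h) <;>
      have e := expo_inj h <;> omega
  · have := mon_sum m
    have := mon_sum m'
    simp only [chainPivot] at h
    split_ifs at h <;>
      have e := expo_inj h <;>
      first
      | (exfalso; omega)
      | (rw [mon_ext (m := m) (m' := m') (by omega) (by omega)])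

theorem prod_chainPivotCoeff (d : ℤ) : ∏ j, chainPivotCoeff d j = 5 ^ 45 * 6 ^ 21 * d ^ 21 := by
  rw [Fintype.prod_sum_type, Fintype.prod_prod_type, Fin.prod_univ_three]
  simp only [chainPivotCoeff, Matrix.cons_val]
  rw [prod_mon 3 fun _ _ _ => (5 : ℤ), prod_mon 3 fun _ b _ => if b = 0 then (1 : ℤ) else 5,
    prod_mon 3 fun _ b c => if c = 0 ∧ b ≠ 0 then (1 : ℤ) else 6 * d,
    prod_mon 4 fun a b _ => if a = 4 then -30 * d else if b = 4 then (-25 : ℤ) else 150 * d]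
  simp [Finset.prod_range_succ]
  ring

/-- The Sylvester determinant of `x⁵y + y⁵z + d z⁶`. -/
theorem aeval_chain_genericDet (d : ℤ) (rows : Fin 45 ≃ Mon 8) (cols : Fin 45 ≃ Col) :
    ∃ c : Mon 6 → ℤ, ∃ ε : ℤˣ,
      aeval c (genericDet rows cols) = ε * (5 ^ 45 * 6 ^ 21 * d ^ 21) := by
  let F : MvPolynomial (Fin 3) ℤ :=
    monomial (expo 5 1 0) 1 + monomial (expo 0 5 1) 1 + monomial (expo 0 0 6) d
  let c := coeffs F
  have hF : sextic c = F := sextic_coeffs (by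
    refine IsHomogeneous.add (IsHomogeneous.add ?_ ?_) ?_ <;>
      exact isHomogeneous_monomial_expo _ (by norm_num))
  have h0 : pderiv 0 (sextic c) = monomial (expo 4 1 0) 5 := by
    rw [hF]
    simp [F, pderiv_monomial, expo_sub_single_zero]
  have h1 : pderiv 1 (sextic c) = monomial (expo 5 0 0) 1 + monomial (expo 0 4 1) 5 := by
    rw [hF]
    simp [F, pderiv_monomial, expo_sub_single_one]
  have h2 : pderiv 2 (sextic c) = monomial (expo 0 5 0) 1 + monomial (expo 0 0 5) (6 * d) := by
    rw [hF]
    simp [F, pderiv_monomial, expo_sub_single_two, mul_comm]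
  have hM := isBlock_chainBlock h0 h1 h2
  have hoct : ∀ j, octic c (chainBlock d) j = monomial (chainPivot j) (chainPivotCoeff d j) +
      monomial (chainOther j) (chainOtherCoeff d j) := by
    rintro (⟨i, q⟩ | m)
    · fin_cases i
      · simp only [octic, Fin.zero_eta, h0, monomial_mul_expo, chainPivot, chainPivotCoeff,
          chainOther, chainOtherCoeff, Matrix.cons_val, map_zero, add_zero]
      · simp only [octic, Fin.mk_one, h1, mul_add, monomial_mul_expo, chainPivot, chainPivotCoeff,
          chainOther, chainOtherCoeff, Matrix.cons_val, add_zero]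
        split_ifs
        · rfl
        · exact add_comm _ _
      · simp only [octic, Fin.reduceFinMk, h2, mul_add, monomial_mul_expo, chainPivot,
          chainPivotCoeff, chainOther, chainOtherCoeff, Matrix.cons_val, add_zero]
        split_ifs
        · rfl
        · exact add_comm _ _
    · have hm := mon_sum m
      simp only [octic, chainPivot, chainPivotCoeff, chainOther, chainOtherCoeff, map_zero,
        add_zero]
      unfold chainBlock
      split_ifs with e0 e1
      · simp [det_fin_three, monomial_expo]
        ring
      · simp [det_fin_three, monomial_expo]
        ring
      · rw [show 4 - m.1 0 = 3 - m.1 0 + 1 by omega, show 4 - m.1 1 = 3 - m.1 1 + 1 by omega,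
          show 5 - m.1 2 = 4 - m.1 2 + 1 by omega]
        simp [det_fin_three, monomial_expo]
        ring
  obtain ⟨ε, hε⟩ := det_sylvester_of_pivots chainPivot chainOther (chainPivotCoeff d)
    (chainOtherCoeff d) chainLevel hoct chainPivot_degree chainPivot_injective (chainLevel_lt d)
    rows cols
  refine ⟨c, ε, ?_⟩
  rw [← det_sylvester_eq_aeval_genericDet hM, hε, prod_chainPivotCoeff]
  rfl

/-! ### Three forms without a common zero -/

/-- The prime ideal generated by the first `k` of the three variables, as the kernel of the
substitution of `0` for these variables. -/
def varIdeal (K : Type*) [Field K] (k : ℕ) : Ideal (MvPolynomial (Fin 3) K) :=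
  RingHom.ker (aeval (fun i : Fin 3 => if i.1 < k then (0 : MvPolynomial (Fin 3) K) else X i))

instance (K : Type*) [Field K] (k : ℕ) : (varIdeal K k).IsPrime := RingHom.ker_isPrime _

theorem X_mem_varIdeal_iff {K : Type*} [Field K] {k : ℕ} {i : Fin 3} :
    (X i : MvPolynomial (Fin 3) K) ∈ varIdeal K k ↔ i.1 < k := by
  rw [varIdeal, RingHom.mem_ker, aeval_X]
  split_ifs with h
  · simp [h]
  · simp [h, X_ne_zero]

theorem varIdeal_lt {K : Type*} [Field K] (k : Fin 3) :
    varIdeal K k.1 < varIdeal K (k.1 + 1) := by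
  refine lt_of_le_not_ge ?_ fun h => ?_
  · intro p hp
    rw [varIdeal, RingHom.mem_ker] at hp ⊢
    have : (aeval (fun i : Fin 3 => if i.1 < k.1 + 1 then (0 : MvPolynomial (Fin 3) K) else X i)) =
        (aeval (fun i : Fin 3 => if i.1 < k.1 + 1 then (0 : MvPolynomial (Fin 3) K) else X i)).comp
        (aeval (R := K)
          (fun i : Fin 3 => if i.1 < k.1 then (0 : MvPolynomial (Fin 3) K) else X i)) := by
      refine MvPolynomial.algHom_ext fun i => ?_
      rw [AlgHom.comp_apply, aeval_X, aeval_X]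
      by_cases hi : i.1 < k.1
      · rw [if_pos hi, if_pos (by omega), map_zero]
      · rw [if_neg hi, aeval_X]
    rw [this, AlgHom.comp_apply, hp, map_zero]
  · exact lt_irrefl _ (X_mem_varIdeal_iff.1 (h (X_mem_varIdeal_iff.2 (Nat.lt_succ_self k.1))))

theorem three_le_height_varIdeal (K : Type*) [Field K] : 3 ≤ (varIdeal K 3).height := by
  have h0 := Ideal.height_add_one_le_of_lt_of_isPrime (varIdeal_lt (K := K) 0)
  have h1 := Ideal.height_add_one_le_of_lt_of_isPrime (varIdeal_lt (K := K) 1)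
  have h2 := Ideal.height_add_one_le_of_lt_of_isPrime (varIdeal_lt (K := K) 2)
  simp only [Fin.val_zero, Fin.val_one, Fin.val_two] at h0 h1 h2
  calc (3 : ℕ∞) ≤ (varIdeal K 0).height + 1 + 1 + 1 := by
        rw [add_assoc, add_assoc]
        exact le_add_self
    _ ≤ (varIdeal K 3).height := (add_le_add_left ((add_le_add_left h0 1).trans h1) 1).trans h2

theorem mem_varIdeal_three_iff {K : Type*} [Field K] {p : MvPolynomial (Fin 3) K} :
    p ∈ varIdeal K 3 ↔ coeff 0 p = 0 := by
  have : (fun i : Fin 3 => if i.1 < 3 then (0 : MvPolynomial (Fin 3) K) else X i) = fun _ => 0 := by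
    funext i
    rw [if_pos i.2]
  rw [varIdeal, RingHom.mem_ker, this, aeval_zero', algebraMap_eq, C_eq_zero]
  rfl

theorem varIdeal_three_le {K : Type*} [Field K] {P : Ideal (MvPolynomial (Fin 3) K)}
    (h : ∀ i, X i ∈ P) : varIdeal K 3 ≤ P := by
  intro p hp
  rw [mem_varIdeal_three_iff] at hp
  have : p ∈ Ideal.span (X '' (Set.univ : Set (Fin 3)) : Set (MvPolynomial (Fin 3) K)) := by
    rw [mem_ideal_span_X_image]
    intro m hm
    by_contra! h0
    have : m = 0 := Finsupp.ext fun i => h0 i (Set.mem_univ i)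
    rw [this, mem_support_iff] at hm
    exact hm hp
  refine Ideal.span_le.2 ?_ this
  rintro _ ⟨i, _, rfl⟩
  exact h i

/-- By the Nullstellensatz, the ideal of three polynomials with no common zero but the origin
contains powers of the variables. -/
theorem exists_X_pow_mem_span {K : Type*} [Field K] [IsAlgClosed K]
    {f : Fin 3 → MvPolynomial (Fin 3) K}
    (hz : ∀ v : Fin 3 → K, (∀ i, eval v (f i) = 0) → v = 0) :
    ∃ N, ∀ i, X i ^ N ∈ Ideal.span (Set.range f) := by
  have hr : ∀ i, X i ∈ (Ideal.span (Set.range f)).radical := by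
    intro i
    rw [← vanishingIdeal_zeroLocus_eq_radical (K := K), mem_vanishingIdeal_iff]
    intro v hv
    have : v = 0 := hz v fun i => by
      simpa [aeval_eq_eval] using hv (f i) (Ideal.subset_span ⟨i, rfl⟩)
    simp [this]
  choose n hn using fun i => Ideal.mem_radical_iff.1 (hr i)
  refine ⟨∑ i, n i, fun i => ?_⟩
  exact Ideal.mem_of_dvd _ (pow_dvd_pow _ (Finset.single_le_sum (fun _ _ => Nat.zero_le _)
    (Finset.mem_univ i))) (hn i)

section

variable {K : Type*} [Field K] {f : Fin 3 → MvPolynomial (Fin 3) K} {d : ℕ}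

attribute [local instance] MvPolynomial.gradedAlgebra in
/-- If a power of every variable lies in the ideal of three forms, then any two of the forms are
coprime: otherwise the irrelevant ideal, of height three, would be minimal over the ideal
generated by a common factor and the third form. -/
theorem isRelPrime_of_X_pow_mem_span (hd : 0 < d) (hf : ∀ i, (f i).IsHomogeneous d) {N : ℕ}
    (hN : ∀ i, X i ^ N ∈ Ideal.span (Set.range f)) : IsRelPrime (f 0) (f 1) := by
  classical
  intro g h0 h1
  by_contra hg
  obtain ⟨P, hP⟩ := Ideal.nonempty_minimalPrimes (I := Ideal.span {g}) (by
    rwa [Ne, Ideal.span_singleton_eq_top])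
  have hPp : P.IsPrime := hP.isPrime
  have hP1 : P.height ≤ 1 := Ideal.height_le_one_of_isPrincipal_of_mem_minimalPrimes _ _ hP
  have hgP : g ∈ P := hP.1.2 (Ideal.mem_span_singleton_self g)
  -- the homogeneous core of `P` is a prime ideal containing `f 0` and `f 1`, principal as its
  -- height is at most one
  let Q : Ideal (MvPolynomial (Fin 3) K) :=
    (P.homogeneousCore (homogeneousSubmodule (Fin 3) K)).toIdeal
  have hQp : Q.IsPrime := hPp.homogeneousCore
  have hQP : Q ≤ P := Ideal.toIdeal_homogeneousCore_le _ P
  have hfQ : ∀ i, g ∣ f i → f i ∈ Q := fun i hi =>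
    Ideal.mem_homogeneousCore_of_homogeneous_of_mem ⟨d, hf i⟩ (Ideal.mem_of_dvd _ hi hgP)
  have hQ1 : Q.height ≤ 1 := (Ideal.height_mono hQP).trans hP1
  obtain ⟨q, hq⟩ : ∃ q, Q = Ideal.span {q} := by
    by_cases hQ0 : Q = ⊥
    · exact ⟨0, by rw [hQ0, Ideal.span_singleton_eq_bot.2 rfl]⟩
    · obtain ⟨q, hqQ, hq⟩ := hQp.exists_mem_prime_of_ne_bot hQ0
      refine ⟨q, Ideal.eq_span_singleton_of_height_eq_one (le_antisymm hQ1 ?_) hqQ hq⟩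
      rw [Order.one_le_iff_pos, pos_iff_ne_zero, Ne, Ideal.height_eq_zero_iff_eq_bot]
      exact hQ0
  have hQm : Q ≤ varIdeal K 3 := by
    intro p hp
    rw [mem_varIdeal_three_iff]
    by_contra hne
    have hc : homogeneousComponent 0 p ∈ Q :=
      homogeneousComponent_mem_of_mem (P.homogeneousCore (homogeneousSubmodule (Fin 3) K)).2 hp 0
    rw [homogeneousComponent_zero] at hc
    exact hQp.ne_top (Ideal.eq_top_of_isUnit_mem _ hc ((isUnit_iff_ne_zero.2 hne).map C))
  have hf2 : f 2 ∈ varIdeal K 3 := by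
    rw [mem_varIdeal_three_iff]
    exact (hf 2).coeff_eq_zero (by simpa using hd.ne)
  have hmin : varIdeal K 3 ∈ (Ideal.span (({q, f 2} : Finset (MvPolynomial (Fin 3) K)) :
      Set (MvPolynomial (Fin 3) K))).minimalPrimes := by
    refine ⟨⟨inferInstance, ?_⟩, ?_⟩
    · rw [Ideal.span_le]
      intro p hp
      simp only [Finset.coe_insert, Finset.coe_singleton, Set.mem_insert_iff,
        Set.mem_singleton_iff] at hp
      rcases hp with rfl | rfl
      · exact hQm (hq ▸ Ideal.mem_span_singleton_self _)
      · exact hf2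
    · rintro I ⟨hI, hle⟩ -
      have hqI : Q ≤ I := by
        rw [hq, Ideal.span_singleton_le_iff_mem]
        exact hle (Ideal.subset_span (by simp))
      refine varIdeal_three_le fun i => hI.mem_of_pow_mem N (Ideal.span_le.2 ?_ (hN i))
      rintro _ ⟨j, rfl⟩
      fin_cases j
      · exact hqI (hfQ 0 h0)
      · exact hqI (hfQ 1 h1)
      · exact hle (Ideal.subset_span (by simp))
  have := (three_le_height_varIdeal K).trans
    ((Ideal.height_le_card_of_mem_minimalPrimes_span_finset hmin).trans
      (Nat.cast_le.2 Finset.card_le_two))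
  exact absurd this (by decide)

theorem exists_eq_mul_of_isRelPrime {A : Type*} [CommRing A] [IsDomain A] [DecompositionMonoid A]
    {a b u v : A} (hab : IsRelPrime a b) (hb : b ≠ 0) (h : u * a + v * b = 0) :
    ∃ s, u = s * b ∧ v = -(s * a) := by
  obtain ⟨s, rfl⟩ : b ∣ u := hab.symm.dvd_of_dvd_mul_right ⟨-v, by linear_combination h⟩
  refine ⟨s, mul_comm _ _, mul_right_cancel₀ hb ?_⟩
  linear_combination h

/-- The ideal of two coprime polynomials in three variables is saturated: the irrelevant ideal is
not associated to it. -/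
theorem mem_span_pair_of_X_mul_mem {a b : MvPolynomial (Fin 3) K} (hab : IsRelPrime a b)
    (hb : b ≠ 0) {h : MvPolynomial (Fin 3) K} (hX : ∀ i, X i * h ∈ Ideal.span {a, b}) :
    h ∈ Ideal.span {a, b} := by
  simp only [Ideal.mem_span_pair] at hX ⊢
  choose p q hpq using hX
  have hs : ∀ i j, ∃ s, X j * p i - X i * p j = s * b ∧ X j * q i - X i * q j = -(s * a) :=
    fun i j => exists_eq_mul_of_isRelPrime hab hb
      (by linear_combination X j * hpq i - X i * hpq j)
  obtain ⟨s, hs1, hs2⟩ := hs 0 1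
  obtain ⟨t, ht1, -⟩ := hs 0 2
  obtain ⟨u, hu1, -⟩ := hs 1 2
  have hK : X 2 * s - X 1 * t + X 0 * u = 0 := by
    refine mul_right_cancel₀ hb ?_
    linear_combination X 1 * ht1 - X 2 * hs1 - X 0 * hu1
  obtain ⟨w, hw⟩ := exists_eq_cross_of_sum_mul_X_pow_eq_zero (fun _ => 1) ![u, -t, s] (by
    simp only [Fin.sum_univ_three, Matrix.cons_val, pow_one]
    linear_combination hK)
  have hw2 : s = w 0 * X 1 - w 1 * X 0 := by simpa [cross_apply] using congrFun hw 2
  have key : ∀ P : MvPolynomial (Fin 3) K, (∃ P', X 1 * P = X 0 * P') → ∃ P', P = P' * X 0 := by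
    rintro P ⟨P', h'⟩
    have := mem_span_X_pow_of_mul_X_pow_mem (fun _ => 1) {0} (j := 1) (by simp) 1 (p := P) (by
      rw [Set.image_singleton, Ideal.mem_span_singleton']
      exact ⟨P', by linear_combination -h'⟩)
    rw [Set.image_singleton, Ideal.mem_span_singleton'] at this
    obtain ⟨y, hy⟩ := this
    exact ⟨y, by rw [← hy, pow_one]⟩
  obtain ⟨p', hp'⟩ := key (p 0 - w 0 * b) ⟨p 1 - w 1 * b, by
    linear_combination hs1 + b * hw2⟩
  obtain ⟨q', hq'⟩ := key (q 0 + w 0 * a) ⟨q 1 + w 1 * a, by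
    linear_combination hs2 - a * hw2⟩
  refine ⟨p', q', mul_left_cancel₀ (X_ne_zero (0 : Fin 3)) ?_⟩
  linear_combination hpq 0 - a * hp' - b * hq'

/-- The third of three forms is regular modulo the first two if their ideal contains powers of the
variables. -/
theorem mem_span_pair_of_mul_mem (hd : 0 < d) (hf : ∀ i, (f i).IsHomogeneous d) {N : ℕ}
    (hN : ∀ i, X i ^ N ∈ Ideal.span (Set.range f)) (h1 : f 1 ≠ 0) {h : MvPolynomial (Fin 3) K}
    (hh : h * f 2 ∈ Ideal.span {f 0, f 1}) : h ∈ Ideal.span {f 0, f 1} := by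
  have hrel := isRelPrime_of_X_pow_mem_span hd hf hN
  -- otherwise `f 2` lies in an associated prime, which then contains all the variables
  by_contra hne
  obtain ⟨P, hP, hle⟩ := exists_le_isAssociatedPrime_of_isNoetherianRing (MvPolynomial (Fin 3) K)
    (Ideal.Quotient.mk (Ideal.span {f 0, f 1}) h) (by
      rwa [Ne, Ideal.Quotient.eq_zero_iff_mem])
  rw [isAssociatedPrime_iff] at hP
  obtain ⟨hPp, y, rfl⟩ := hP
  obtain ⟨g, rfl⟩ := Ideal.Quotient.mk_surjective y
  have hmem : ∀ g r : MvPolynomial (Fin 3) K,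
      r ∈ (⊥ : Submodule (MvPolynomial (Fin 3) K) (MvPolynomial (Fin 3) K ⧸
        Ideal.span {f 0, f 1})).colon {Ideal.Quotient.mk (Ideal.span {f 0, f 1}) g} ↔
      r * g ∈ Ideal.span {f 0, f 1} := by
    intro g r
    rw [Submodule.mem_colon_singleton, Submodule.mem_bot, ← Ideal.Quotient.eq_zero_iff_mem]
    rfl
  have hg : g ∉ Ideal.span {f 0, f 1} := fun hg => hPp.ne_top
    ((Ideal.eq_top_iff_one _).2 ((hmem g 1).2 (by rwa [one_mul])))
  refine hg (mem_span_pair_of_X_mul_mem hrel h1 fun i => ?_)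
  rw [← hmem]
  refine hPp.mem_of_pow_mem N (Ideal.span_le.2 ?_ (hN i))
  rintro _ ⟨j, rfl⟩
  fin_cases j
  · exact (hmem _ _).2 (Ideal.mul_mem_right _ _ (Ideal.subset_span (by simp)))
  · exact (hmem _ _).2 (Ideal.mul_mem_right _ _ (Ideal.subset_span (by simp)))
  · refine hle ((hmem _ _).2 ?_)
    rw [mul_comm]
    exact hh

attribute [local instance] MvPolynomial.gradedAlgebra in
theorem homogeneousComponent_mul_eq_zero {n : ℕ} (u : MvPolynomial (Fin 3) K)
    {g : MvPolynomial (Fin 3) K} (hg : g.IsHomogeneous d) (hn : n < d) :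
    homogeneousComponent n (u * g) = 0 := by
  rw [← decomposition.decompose'_apply]
  exact DirectSum.coe_decompose_mul_of_right_mem_of_not_le (homogeneousSubmodule (Fin 3) K)
    (a := u) ((mem_homogeneousSubmodule d g).2 hg) (not_le.2 hn)

theorem eq_zero_of_isHomogeneous_of_eq_mul {n : ℕ} {p u g : MvPolynomial (Fin 3) K}
    (hp : p.IsHomogeneous n) (hg : g.IsHomogeneous d) (hn : n < d) (h : p = u * g) : p = 0 := by
  rw [← homogeneousComponent_eq_self hp, h, homogeneousComponent_mul_eq_zero u hg hn]

/-- Three forms of degree `d` whose ideal contains powers of the variables have no syzygies of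
degree less than `d`. -/
theorem syzygy_eq_zero (hf : ∀ i, (f i).IsHomogeneous d) {N : ℕ}
    (hN : ∀ i, X i ^ N ∈ Ideal.span (Set.range f)) {n : ℕ} (hn : n < d)
    {u : Fin 3 → MvPolynomial (Fin 3) K} (hu : ∀ i, (u i).IsHomogeneous n)
    (h : ∑ i, u i * f i = 0) : u = 0 := by
  have hd : 0 < d := by omega
  have hrel := isRelPrime_of_X_pow_mem_span hd hf hN
  have h1 : f 1 ≠ 0 := by
    intro h1
    rw [h1, isRelPrime_zero_right] at hrel
    have h2 : f 0 ∈ varIdeal K 3 := by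
      rw [mem_varIdeal_three_iff]
      exact (hf 0).coeff_eq_zero (by simpa using hd.ne)
    exact (inferInstance : (varIdeal K 3).IsPrime).ne_top (Ideal.eq_top_of_isUnit_mem _ h2 hrel)
  rw [Fin.sum_univ_three] at h
  have h2 : u 2 = 0 := by
    have := mem_span_pair_of_mul_mem hd hf hN h1 (h := u 2) (by
      rw [Ideal.mem_span_pair]
      exact ⟨-u 0, -u 1, by linear_combination -h⟩)
    rw [Ideal.mem_span_pair] at this
    obtain ⟨p, q, hpq⟩ := this
    rw [← homogeneousComponent_eq_self (hu 2), ← hpq, map_add,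
      homogeneousComponent_mul_eq_zero p (hf 0) hn, homogeneousComponent_mul_eq_zero q (hf 1) hn,
      add_zero]
  rw [h2, zero_mul, add_zero] at h
  obtain ⟨s, hs0, hs1⟩ := exists_eq_mul_of_isRelPrime hrel h1 h
  funext i
  fin_cases i
  · exact eq_zero_of_isHomogeneous_of_eq_mul (hu 0) (hf 1) hn hs0
  · exact eq_zero_of_isHomogeneous_of_eq_mul (hu 1) (hf 0) hn
      (hs1.trans (neg_mul_eq_neg_mul _ _))
  · exact h2

end

/-! ### The Sylvester determinant vanishes exactly at singular sextics -/

/-- Cramer's rule. -/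
theorem det_mul_mem_span {A : Type*} [CommRing A] {n : ℕ} (B : Matrix (Fin n) (Fin n) A)
    {v f : Fin n → A} (h : f = B *ᵥ v) (i : Fin n) : v i * B.det ∈ Ideal.span (Set.range f) := by
  have : v i * B.det = (B.adjugate *ᵥ f) i := by
    rw [h, mulVec_mulVec, adjugate_mul, smul_mulVec, one_mulVec, Pi.smul_apply, smul_eq_mul,
      mul_comm]
  rw [this, mulVec, dotProduct]
  exact Ideal.sum_mem _ fun j _ => Ideal.mul_mem_left _ _ (Ideal.subset_span ⟨j, rfl⟩)

/-- If `f = M v` for the powers `v` of the variables, and if the ideal of the forms `f` contains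
powers of the variables, then the product of `det M` with the socle monomial of the ideal of `v`
is not in the ideal of `f`.  Indeed if `B` expresses high powers of the variables through `f`, then
`det (B M)` is, modulo these powers, a monomial. -/
theorem monomial_mul_det_notMem {K : Type*} [Field K] (a : Fin 3 →₀ ℕ)
    {f : Fin 3 → MvPolynomial (Fin 3) K} {M : Matrix (Fin 3) (Fin 3) (MvPolynomial (Fin 3) K)}
    (hM : f = M *ᵥ fun i => X i ^ (a i + 1)) {N : ℕ}
    (hN : ∀ i, X i ^ N ∈ Ideal.span (Set.range f)) :
    monomial a 1 * M.det ∉ Ideal.span (Set.range f) := by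
  intro hmem
  let n : ℕ := N + ∑ i, (a i + 1)
  have hn : ∀ i, a i + 1 ≤ n := fun i =>
    (Finset.single_le_sum (f := fun i => a i + 1) (fun _ _ => Nat.zero_le _)
      (Finset.mem_univ i)).trans (Nat.le_add_left _ _)
  have hB : ∀ i, ∃ b : Fin 3 → MvPolynomial (Fin 3) K, ∑ j, b j * f j = X i ^ n := fun i =>
    (Ideal.mem_span_range_iff_exists_fun).1
      (Ideal.mem_of_dvd _ (pow_dvd_pow _ (Nat.le_add_right _ _)) (hN i))
  choose B hB using hB
  let B' : Matrix (Fin 3) (Fin 3) (MvPolynomial (Fin 3) K) := of B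
  have hBf : (fun i => X i ^ n : Fin 3 → MvPolynomial (Fin 3) K) = B' *ᵥ f := by
    funext i
    exact (hB i).symm
  let g : Fin 3 → MvPolynomial (Fin 3) K := fun i => X i ^ n
  have hdiag : g = diagonal (fun i => X i ^ (n - (a i + 1))) *ᵥ fun i => X i ^ (a i + 1) := by
    funext i
    rw [mulVec_diagonal, ← pow_add, Nat.sub_add_cancel (hn i)]
  have hBM : g = (B' * M) *ᵥ fun i => X i ^ (a i + 1) := by
    rw [← mulVec_mulVec, ← hM, ← hBf]
  obtain ⟨u, hu⟩ := exists_det_sub_det (fun i => a i + 1) _ _ g hdiag hBM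
  rw [det_diagonal, det_mul] at hu
  have hg : ∀ i, g i ∈ Ideal.span (Set.range g) := fun i => Ideal.subset_span ⟨i, rfl⟩
  have h1 : monomial a 1 * (B'.det * M.det) ∈ Ideal.span (Set.range g) := by
    obtain ⟨w, hw⟩ := (Ideal.mem_span_range_iff_exists_fun).1 hmem
    have : monomial a 1 * (B'.det * M.det) = ∑ i, w i * (f i * B'.det) := by
      rw [show monomial a 1 * (B'.det * M.det) = monomial a 1 * M.det * B'.det by ring, ← hw,
        Finset.sum_mul]
      exact Finset.sum_congr rfl fun i _ => by ring
    rw [this]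
    exact Ideal.sum_mem _ fun i _ => Ideal.mul_mem_left _ _ (det_mul_mem_span B' hBf i)
  have h2 : monomial a 1 * ∏ i, (X i ^ (n - (a i + 1)) : MvPolynomial (Fin 3) K) ∈
      Ideal.span (Set.range g) := by
    have : monomial a 1 * ∏ i, (X i ^ (n - (a i + 1)) : MvPolynomial (Fin 3) K) =
        monomial a 1 * (B'.det * M.det) - monomial a 1 * ∑ i, u i * g i := by
      rw [← hu]
      ring
    rw [this]
    exact Ideal.sub_mem _ h1 (Ideal.mul_mem_left _ _
      (Ideal.sum_mem _ fun i _ => Ideal.mul_mem_left _ _ (hg i)))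
  have h3 : monomial a 1 * ∏ i, (X i ^ (n - (a i + 1)) : MvPolynomial (Fin 3) K) =
      monomial (a + ∑ i, Finsupp.single i (n - (a i + 1))) 1 := by
    simp only [X_pow_eq_monomial]
    rw [← monomial_sum_one, monomial_mul, one_mul]
  have h4 : Set.range g =
      (fun s => monomial s (1 : K)) '' Set.range fun i => Finsupp.single i n := by
    rw [← Set.range_comp]
    congr 1
    funext i
    simp [g, X_pow_eq_monomial]
  rw [h3, h4, mem_ideal_span_monomial_image] at h2
  obtain ⟨_, ⟨i, rfl⟩, hle⟩ := h2 _ (by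
    rw [mem_support_iff, coeff_monomial, if_pos rfl]
    exact one_ne_zero)
  rw [Finsupp.single_le_iff, Finsupp.add_apply, Finsupp.finsetSum_apply,
    Finset.sum_eq_single i (fun j _ hj => by simp [hj]) (by simp),
    Finsupp.single_eq_same] at hle
  have := hn i
  omega

theorem exists_lt_of_ne {d : ℕ} {m m' : Mon d} (h : m ≠ m') : ∃ i, m'.1 i + 1 ≤ m.1 i := by
  by_contra! hlt
  have h0 := hlt 0
  have h1 := hlt 1
  have h2 := hlt 2
  have := mon_sum m
  have := mon_sum m'
  exact h (mon_ext (by omega) (by omega))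

/-- The Sylvester determinant of a sextic whose partial derivatives have no common zero does not
vanish. -/
theorem det_sylvester_ne_zero {K : Type*} [Field K] [IsAlgClosed K] {c : Mon 6 → K}
    {M : Mon 4 → Matrix (Fin 3) (Fin 3) (MvPolynomial (Fin 3) K)} (h : ∀ m, IsBlock c m (M m))
    (hz : ∀ v : Fin 3 → K, (∀ i, eval v (pderiv i (sextic c)) = 0) → v = 0)
    (rows : Fin 45 ≃ Mon 8) (cols : Fin 45 ≃ Col) : (sylvester c M rows cols).det ≠ 0 := by
  rw [Ne, ← exists_mulVec_eq_zero_iff]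
  rintro ⟨w, hw0, hw⟩
  refine hw0 ?_
  let l : Col → K := fun j => w (cols.symm j)
  have hsum : ∑ j, C (l j) * octic c M j = 0 := by
    have hhom : (∑ j, C (l j) * octic c M j).IsHomogeneous 8 :=
      IsHomogeneous.sum _ _ _ fun j _ => (isHomogeneous_octic h j).C_mul _
    rw [← sum_monomial_coeff hhom]
    refine Finset.sum_eq_zero fun m _ => ?_
    have := congrFun hw (rows.symm m)
    rw [mulVec, dotProduct, Pi.zero_apply] at this
    rw [coeff_sum, ← Equiv.sum_comp cols, monomial_eq_zero, ← this]
    refine Finset.sum_congr rfl fun b _ => ?_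
    rw [coeff_C_mul, mul_comm]
    simp [l, sylvester]
  let f : Fin 3 → MvPolynomial (Fin 3) K := fun i => pderiv i (sextic c)
  obtain ⟨N, hN⟩ := exists_X_pow_mem_span (f := f) hz
  have hfJ : ∀ i, f i ∈ Ideal.span (Set.range f) := fun i => Ideal.subset_span ⟨i, rfl⟩
  rw [Fintype.sum_sum_type] at hsum
  have hG : ∑ m, C (l (Sum.inr m)) * (M m).det ∈ Ideal.span (Set.range f) := by
    have : ∑ m, C (l (Sum.inr m)) * (M m).det =
        - ∑ x : Fin 3 × Mon 3, C (l (Sum.inl x)) * (monomial x.2.1 1 * f x.1) :=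
      eq_neg_of_add_eq_zero_right hsum
    rw [this]
    exact Ideal.neg_mem_iff _ |>.2 (Ideal.sum_mem _ fun x _ =>
      Ideal.mul_mem_left _ _ (Ideal.mul_mem_left _ _ (hfJ _)))
  have hinr : ∀ m, l (Sum.inr m) = 0 := by
    intro m
    by_contra hne
    -- multiplication by the monomial `m` kills all summands but one
    have h1 := Ideal.mul_mem_left _ (monomial m.1 1) hG
    rw [Finset.mul_sum, ← Finset.add_sum_erase _ _ (Finset.mem_univ m)] at h1
    have h2 : ∑ m' ∈ Finset.univ.erase m, monomial m.1 1 * (C (l (Sum.inr m')) * (M m').det) ∈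
        Ideal.span (Set.range f) := by
      refine Ideal.sum_mem _ fun m' hm' => ?_
      obtain ⟨i, hi⟩ := exists_lt_of_ne (Finset.ne_of_mem_erase hm').symm
      have hdvd : (X i ^ (m'.1 i + 1) : MvPolynomial (Fin 3) K) ∣ monomial m.1 1 := by
        rw [X_pow_eq_monomial, monomial_dvd_monomial]
        exact ⟨Or.inr (Finsupp.single_le_iff.2 hi), one_dvd _⟩
      obtain ⟨r, hr⟩ := hdvd
      rw [hr, show X i ^ (m'.1 i + 1) * r * (C (l (Sum.inr m')) * (M m').det) =
        r * C (l (Sum.inr m')) * (X i ^ (m'.1 i + 1) * (M m').det) by ring]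
      exact Ideal.mul_mem_left _ _ (det_mul_mem_span (M m') (h m').identity i)
    have h3 := (Ideal.add_mem_iff_left _ h2).1 h1
    refine monomial_mul_det_notMem m.1 (h m).identity hN ?_
    have h4 := Ideal.mul_mem_left _ (C (l (Sum.inr m))⁻¹) h3
    rwa [show C (l (Sum.inr m))⁻¹ * (monomial m.1 1 * (C (l (Sum.inr m)) * (M m).det)) =
      (C (l (Sum.inr m))⁻¹ * C (l (Sum.inr m))) * (monomial m.1 1 * (M m).det) by ring, ← C_mul,
      inv_mul_cancel₀ hne, C_1, one_mul] at h4
  have hinl : ∀ x, l (Sum.inl x) = 0 := by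
    let u : Fin 3 → MvPolynomial (Fin 3) K := fun i =>
      ∑ q : Mon 3, monomial q.1 (l (Sum.inl (i, q)))
    have hu : u = 0 := by
      refine syzygy_eq_zero (d := 5) (n := 3) (fun i => isHomogeneous_pderiv_sextic c i) hN
        (by norm_num) (fun i => IsHomogeneous.sum _ _ _ fun q _ =>
          isHomogeneous_monomial _ (mon_degree q)) ?_
      have h5 : ∑ m, C (l (Sum.inr m)) * octic c M (Sum.inr m) = 0 :=
        Finset.sum_eq_zero fun m _ => by rw [hinr, C_0, zero_mul]
      rw [h5, add_zero, Fintype.sum_prod_type] at hsum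
      rw [← hsum]
      refine Finset.sum_congr rfl fun i _ => ?_
      rw [Finset.sum_mul]
      refine Finset.sum_congr rfl fun q _ => ?_
      rw [octic, ← mul_assoc, C_mul_monomial, mul_one]
    rintro ⟨i, q⟩
    have := congrArg (coeff q.1) (congrFun hu i)
    rwa [coeff_sum_monomial fun q => l (Sum.inl (i, q))] at this
  funext b
  have : l (cols b) = 0 := by
    rcases cols b with x | m
    · exact hinl x
    · exact hinr m
  simpa [l] using this

/-- The Sylvester determinant of a sextic whose partial derivatives have a common zero vanishes:
the monomials at this point are a linear relation between the rows. -/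
theorem det_sylvester_eq_zero {K : Type*} [Field K] {c : Mon 6 → K}
    {M : Mon 4 → Matrix (Fin 3) (Fin 3) (MvPolynomial (Fin 3) K)} (h : ∀ m, IsBlock c m (M m))
    {v : Fin 3 → K} (hv : v ≠ 0) (hz : ∀ i, eval v (pderiv i (sextic c)) = 0)
    (rows : Fin 45 ≃ Mon 8) (cols : Fin 45 ≃ Col) : (sylvester c M rows cols).det = 0 := by
  obtain ⟨k, hk⟩ : ∃ k, v k ≠ 0 := by
    by_contra! h0
    exact hv (funext h0)
  have hoct : ∀ j, eval v (octic c M j) = 0 := by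
    rintro (⟨i, q⟩ | m)
    · rw [octic, map_mul, hz, mul_zero]
    · have hdet := det_mul_mem_span (M m) (h m).identity k
      obtain ⟨u, hu⟩ := (Ideal.mem_span_range_iff_exists_fun).1 hdet
      have := congrArg (eval v) hu
      rw [map_sum, Finset.sum_eq_zero fun i _ => by rw [map_mul, hz, mul_zero], map_mul, map_pow,
        eval_X] at this
      exact (mul_eq_zero.1 this.symm).resolve_left (pow_ne_zero _ hk)
  rw [← exists_vecMul_eq_zero_iff]
  refine ⟨fun a => eval v (monomial (rows a).1 1), ?_, ?_⟩
  · intro h0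
    have h1 := congrFun h0 (rows.symm ⟨Finsupp.single k 8, by
      rw [mem_mon_iff, Finsupp.degree_single]⟩)
    simp [← X_pow_eq_monomial, hk] at h1
  · funext b
    have := hoct (cols b)
    rw [← sum_monomial_coeff (isHomogeneous_octic h (cols b)), map_sum] at this
    rw [vecMul, dotProduct, Pi.zero_apply, ← this, ← Equiv.sum_comp rows]
    refine Finset.sum_congr rfl fun a _ => ?_
    simp only [sylvester, of_apply]
    rw [eval_monomial, eval_monomial]
    ring

/-- By Euler's relation a common zero of the partial derivatives is a zero of the sextic. -/
theorem isSingular_iff {c : Mon 6 → ℂ} :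
    IsSingular c ↔ ∃ v : Fin 3 → ℂ, v ≠ 0 ∧ ∀ i, eval v (pderiv i (sextic c)) = 0 := by
  refine ⟨fun ⟨v, hv, _, h⟩ => ⟨v, hv, h⟩, fun ⟨v, hv, h⟩ => ⟨v, hv, ?_, h⟩⟩
  have := congrArg (eval v) (euler_sextic c)
  rw [map_sum, Finset.sum_eq_zero fun i _ => by rw [map_mul, h, mul_zero], map_mul] at this
  have h6 : eval v (6 : MvPolynomial (Fin 3) ℂ) = 6 := map_ofNat _ 6
  rw [h6] at this
  exact (mul_eq_zero.1 this.symm).resolve_left (by norm_num)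

theorem aeval_genericDet_eq_zero_iff (rows : Fin 45 ≃ Mon 8) (cols : Fin 45 ≃ Col)
    (c : Mon 6 → ℂ) : aeval c (genericDet rows cols) = 0 ↔ IsSingular c := by
  rw [← det_sylvester_eq_aeval_genericDet (isBlock_standardBlock c), isSingular_iff]
  constructor
  · intro h0
    by_contra! hv
    refine det_sylvester_ne_zero (isBlock_standardBlock c) (fun v hz => ?_) rows cols h0
    by_contra hne
    obtain ⟨i, hi⟩ := hv v hne
    exact hi (hz i)
  · rintro ⟨v, hv, hz⟩
    exact det_sylvester_eq_zero (isBlock_standardBlock c) hv hz rows cols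

/-! ### The variety of singular sextics is irreducible -/

/-- For a sextic `F` with coefficients `c`, a point `p` and a linear form `q` with
`q(p) = 1`, this is `F` minus the form `q ^ 5 (dF(p) - 5 F(p) q)` with the same value and the same
partial derivatives at `p`, hence a sextic singular at `p`.  The powers of `q(p)` make this an
identity of polynomials. -/
def singularization {B : Type*} [CommRing B] (p q : Fin 3 → B) (c : Mon 6 → B) :
    MvPolynomial (Fin 3) B :=
  C ((∑ i, q i * p i) ^ 6) * sextic c -
    C (∑ i, q i * p i) * ((∑ i, C (q i) * X i) ^ 5 *
      ∑ i, C (eval p (pderiv i (sextic c))) * X i) +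
    C (5 * eval p (sextic c)) * (∑ i, C (q i) * X i) ^ 6

theorem isHomogeneous_singularization {B : Type*} [CommRing B] (p q : Fin 3 → B) (c : Mon 6 → B) :
    (singularization p q c).IsHomogeneous 6 := by
  have hL : ∀ g : Fin 3 → B, (∑ i, C (g i) * X i : MvPolynomial (Fin 3) B).IsHomogeneous 1 :=
    fun g => IsHomogeneous.sum _ _ _ fun i _ => isHomogeneous_C_mul_X _ _
  exact (((isHomogeneous_sextic c).C_mul _).sub ((((hL q).pow 5).mul (hL _)).C_mul _)).add
    (((hL q).pow 6).C_mul _)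

theorem eval_pderiv_singularization {B : Type*} [CommRing B] (p q : Fin 3 → B) (c : Mon 6 → B)
    (i : Fin 3) : eval p (pderiv i (singularization p q c)) = 0 := by
  have hE := congrArg (eval p) (euler_sextic c)
  simp only [map_sum, map_mul, eval_X, map_ofNat] at hE
  have hp : ∀ g : Fin 3 → B, pderiv i (∑ j, C (g j) * X j : MvPolynomial (Fin 3) B) = C (g i) := by
    intro g
    rw [map_sum, Finset.sum_eq_single i]
    · rw [pderiv_C_mul, pderiv_X_self, mul_one]
    · intro j _ hj
      rw [pderiv_C_mul, pderiv_X_of_ne hj, mul_zero]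
    · simp
  have he : ∀ g : Fin 3 → B, eval p (∑ j, C (g j) * X j : MvPolynomial (Fin 3) B) =
      ∑ j, g j * p j := by
    intro g
    simp
  have hE' : ∑ j, eval p (pderiv j (sextic c)) * p j = 6 * eval p (sextic c) := by
    rw [← hE]
    exact Finset.sum_congr rfl fun j _ => mul_comm _ _
  rw [singularization]
  simp only [map_add, map_sub, pderiv_mul, pderiv_pow, pderiv_C, hp, map_mul,
    map_pow, eval_C, he, hE', map_natCast, map_zero]
  push_cast
  ring

/-- The coefficients of `singularization p q c`. -/
def singularCoeffs {B : Type*} [CommRing B] (p q : Fin 3 → B) (c : Mon 6 → B) : Mon 6 → B :=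
  coeffs (singularization p q c)

theorem singularCoeffs_map {B B' : Type*} [CommRing B] [CommRing B'] (φ : B →+* B')
    (p q : Fin 3 → B) (c : Mon 6 → B) (m : Mon 6) :
    φ (singularCoeffs p q c m) =
      singularCoeffs (fun i => φ (p i)) (fun i => φ (q i)) (fun u => φ (c u)) m := by
  rw [singularCoeffs, coeffs, ← coeff_map]
  have he : ∀ F : MvPolynomial (Fin 3) B,
      φ (eval p F) = eval (fun i => φ (p i)) (MvPolynomial.map φ F) := fun F => by
    rw [eval_map, eval₂_comp]
    rfl
  simp only [singularization, singularCoeffs, coeffs, sextic_map, map_add, map_sub, map_mul,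
    map_pow, map_sum, map_C, map_X, he, pderiv_map, map_ofNat]

theorem isSingular_singularCoeffs (p q : Fin 3 → ℂ) (c : Mon 6 → ℂ) :
    IsSingular (singularCoeffs p q c) := by
  rw [isSingular_iff, singularCoeffs, sextic_coeffs (isHomogeneous_singularization p q c)]
  by_cases hp : p = 0
  -- the origin is not a point of the projective plane, but the singularization is then zero
  · subst hp
    refine ⟨fun _ => 1, fun h => one_ne_zero (congrFun h 0), fun i => ?_⟩
    have h0 : constantCoeff (sextic c) = 0 :=
      (isHomogeneous_sextic c).coeff_eq_zero (d := 0) (by simp)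
    simp [singularization, h0]
  · exact ⟨p, hp, eval_pderiv_singularization p q c⟩

theorem exists_eq_singularCoeffs {c : Mon 6 → ℂ} (hc : IsSingular c) :
    ∃ p q : Fin 3 → ℂ, singularCoeffs p q c = c := by
  obtain ⟨p, hp, h0, h⟩ := hc
  obtain ⟨k, hk⟩ : ∃ k, p k ≠ 0 := by
    by_contra! h0
    exact hp (funext h0)
  refine ⟨p, Pi.single k (p k)⁻¹, ?_⟩
  have h1 : ∑ i, (Pi.single k (p k)⁻¹ : Fin 3 → ℂ) i * p i = 1 := by
    rw [Finset.sum_eq_single k (fun j _ hj => by rw [Pi.single_eq_of_ne hj, zero_mul]) (by simp),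
      Pi.single_eq_same, inv_mul_cancel₀ hk]
  have h2 : singularization p (Pi.single k (p k)⁻¹) c = sextic c := by
    simp [singularization, h1, h0, h]
  funext m
  rw [singularCoeffs, h2]
  exact coeff_sum_monomial c m

/-- The integral polynomial `P` vanishes at all singular sextics. -/
def VanishesOnSingular (P : MvPolynomial (Mon 6) ℤ) : Prop :=
  ∀ c : Mon 6 → ℂ, IsSingular c → aeval c P = 0

/-- The coefficients of the generic singular sextic: the singularization of the generic sextic at
a generic point with respect to a generic linear form. -/
def genericSingularCoeffs : Mon 6 → MvPolynomial ((Fin 3 ⊕ Fin 3) ⊕ Mon 6) ℂ :=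
  singularCoeffs (fun i => X (Sum.inl (Sum.inl i))) (fun i => X (Sum.inl (Sum.inr i)))
    (fun m => X (Sum.inr m))

theorem eval_aeval_genericSingularCoeffs (x : (Fin 3 ⊕ Fin 3) ⊕ Mon 6 → ℂ)
    (P : MvPolynomial (Mon 6) ℤ) :
    eval x (aeval genericSingularCoeffs P) =
      aeval (singularCoeffs (fun i => x (Sum.inl (Sum.inl i))) (fun i => x (Sum.inl (Sum.inr i)))
        (fun m => x (Sum.inr m))) P := by
  have h : (fun m => eval x (genericSingularCoeffs m)) =
      singularCoeffs (fun i => x (Sum.inl (Sum.inl i))) (fun i => x (Sum.inl (Sum.inr i)))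
        (fun m => x (Sum.inr m)) := by
    funext m
    rw [genericSingularCoeffs, singularCoeffs_map]
    simp only [eval_X]
  rw [← h, aeval_def, aeval_def, eval₂_comp_left,
    RingHom.ext_int ((eval x).comp (algebraMap ℤ _)) (algebraMap ℤ ℂ)]
  rfl

/-- As singular sextics are the specializations of the generic one, vanishing at all of them is
vanishing at the generic one. -/
theorem vanishesOnSingular_iff (P : MvPolynomial (Mon 6) ℤ) :
    VanishesOnSingular P ↔ aeval genericSingularCoeffs P = 0 := by
  constructor
  · intro h
    refine MvPolynomial.funext fun x => ?_
    rw [eval_aeval_genericSingularCoeffs, map_zero]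
    exact h _ (isSingular_singularCoeffs _ _ _)
  · intro h c hc
    obtain ⟨p, q, hpq⟩ := exists_eq_singularCoeffs hc
    have := eval_aeval_genericSingularCoeffs (Sum.elim (Sum.elim p q) c) P
    rw [h, map_zero] at this
    simp only [Sum.elim_inl, Sum.elim_inr] at this
    rw [← hpq, this]

theorem VanishesOnSingular.or_of_mul {P Q : MvPolynomial (Mon 6) ℤ}
    (h : VanishesOnSingular (P * Q)) : VanishesOnSingular P ∨ VanishesOnSingular Q := by
  rw [vanishesOnSingular_iff, map_mul, mul_eq_zero] at h
  rwa [vanishesOnSingular_iff, vanishesOnSingular_iff]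

theorem isSingular_zero : IsSingular 0 := by
  rw [isSingular_iff]
  refine ⟨fun _ => 1, fun h => one_ne_zero (congrFun h 0), fun i => ?_⟩
  simp [sextic]

/-! ### The discriminant -/

theorem genericDet_ne_zero (rows : Fin 45 ≃ Mon 8) (cols : Fin 45 ≃ Col) :
    genericDet rows cols ≠ 0 := by
  intro h0
  obtain ⟨c, ε, h⟩ := aeval_chain_genericDet 1 rows cols
  rw [h0, map_zero] at h
  exact absurd h.symm (mul_ne_zero ε.ne_zero (by norm_num))

/-- An irreducible factor that vanishes on the irreducible variety of singular sextics. -/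
theorem exists_irreducible_dvd {P : MvPolynomial (Mon 6) ℤ} (h0 : P ≠ 0)
    (h : VanishesOnSingular P) :
    ∃ q : MvPolynomial (Mon 6) ℤ, Irreducible q ∧ q ∣ P ∧ VanishesOnSingular q := by
  induction P using UniqueFactorizationMonoid.induction_on_prime with
  | h₁ => exact absurd rfl h0
  | h₂ x hx =>
    exact absurd (h 0 isSingular_zero) (hx.map (aeval (0 : Mon 6 → ℂ))).ne_zero
  | h₃ a p ha hp ih =>
    rcases h.or_of_mul with h1 | h1
    · exact ⟨p, hp.irreducible, dvd_mul_right _ _, h1⟩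
    · obtain ⟨q, hq, hqa, hv⟩ := ih ha h1
      exact ⟨q, hq, hqa.mul_left _, hv⟩

theorem exists_isDiscriminant : ∃ Δ : MvPolynomial (Mon 6) ℤ, IsDiscriminant Δ := by
  let rows : Fin 45 ≃ Mon 8 := (Fintype.equivFinOfCardEq card_mon_eight).symm
  let cols : Fin 45 ≃ Col := (Fintype.equivFinOfCardEq card_col).symm
  obtain ⟨q, hq, hdvd, hv⟩ := exists_irreducible_dvd (genericDet_ne_zero rows cols)
    fun c hc => (aeval_genericDet_eq_zero_iff rows cols c).2 hc
  refine ⟨q, hq, fun c => ⟨fun h => ?_, hv c⟩⟩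
  rw [← aeval_genericDet_eq_zero_iff rows cols]
  exact zero_dvd_iff.1 (h ▸ map_dvd (aeval c) hdvd)

theorem eq_C_of_dvd_C {σ : Type*} {q : MvPolynomial σ ℤ} {n : ℤ} (hn : n ≠ 0) (h : q ∣ C n) :
    q = C (coeff 0 q) := by
  obtain ⟨r, hr⟩ := h
  have h0 : q * r ≠ 0 := by
    rw [← hr]
    simpa using hn
  rw [← totalDegree_eq_zero_iff_eq_C]
  have := congrArg totalDegree hr
  rw [totalDegree_C, totalDegree_mul_of_isDomain (left_ne_zero_of_mul h0)
    (right_ne_zero_of_mul h0)] at this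
  omega

/-- An irreducible integral polynomial whose complex zeros are zeros of the irreducible
polynomial `Δ` is constant or associated to `Δ`: this is the Nullstellensatz over `ℚ` followed by
clearing denominators. -/
theorem eq_C_or_associated_of_zeros_subset {σ : Type*} [Finite σ] {q Δ : MvPolynomial σ ℤ}
    (hq : Irreducible q) (hΔ : Irreducible Δ)
    (h : ∀ c : σ → ℂ, aeval c q = 0 → aeval c Δ = 0) :
    q = C (coeff 0 q) ∨ Associated q Δ := by
  have hmem : MvPolynomial.map (algebraMap ℤ ℚ) Δ ∈
      (Ideal.span {MvPolynomial.map (algebraMap ℤ ℚ) q}).radical := by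
    rw [← vanishingIdeal_zeroLocus_eq_radical (K := ℂ), mem_vanishingIdeal_iff]
    intro c hc
    have := hc _ (Ideal.mem_span_singleton_self _)
    rw [aeval_map_algebraMap] at this ⊢
    exact h c this
  obtain ⟨n, hn⟩ := Ideal.mem_radical_iff.1 hmem
  obtain ⟨r, hr⟩ := Ideal.mem_span_singleton'.1 hn
  let : Algebra (MvPolynomial σ ℤ) (MvPolynomial σ ℚ) := algebraMvPolynomial
  obtain ⟨⟨r', ⟨_, s, hs, rfl⟩⟩, hrs⟩ := IsLocalization.surj ((nonZeroDivisors ℤ).map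
    (C : ℤ →+* MvPolynomial σ ℤ)) r
  have hs0 : s ≠ 0 := nonZeroDivisors.ne_zero hs
  have key : C s * Δ ^ n = q * r' := by
    refine map_injective (algebraMap ℤ ℚ) (algebraMap ℤ ℚ).injective_int ?_
    rw [map_mul, map_pow, map_mul, ← hr]
    simp only [algebraMap_def] at hrs
    rw [← hrs]
    change _ = _ * (r * MvPolynomial.map (algebraMap ℤ ℚ) (C s))
    ring
  rcases hq.prime.dvd_or_dvd (Dvd.intro _ key.symm) with h1 | h1
  · exact Or.inl (eq_C_of_dvd_C hs0 h1)
  · exact Or.inr (hq.associated_of_dvd hΔ (hq.prime.dvd_of_dvd_pow h1))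

/-- A polynomial whose complex zeros are singular sextics is, up to an integer factor, a power of
the discriminant. -/
theorem IsDiscriminant.exists_eq_C_mul_pow {Δ : MvPolynomial (Mon 6) ℤ} (hΔ : IsDiscriminant Δ)
    {P : MvPolynomial (Mon 6) ℤ} (h0 : P ≠ 0)
    (h : ∀ c : Mon 6 → ℂ, aeval c P = 0 → IsSingular c) : ∃ (k : ℤ) (e : ℕ), P = C k * Δ ^ e := by
  induction P using UniqueFactorizationMonoid.induction_on_prime with
  | h₁ => exact absurd rfl h0
  | h₂ x hx =>
    refine ⟨coeff 0 x, 0, ?_⟩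
    rw [pow_zero, mul_one]
    exact eq_C_of_dvd_C one_ne_zero (by rw [C_1]; exact isUnit_iff_dvd_one.1 hx)
  | h₃ a p ha hp ih =>
    obtain ⟨k, e, hk⟩ := ih ha fun c hc => h c (by rw [map_mul, hc, mul_zero])
    rcases eq_C_or_associated_of_zeros_subset hp.irreducible hΔ.irreducible fun c hc =>
      (hΔ.zero_iff c).2 (h c (by rw [map_mul, hc, zero_mul])) with h1 | ⟨u, hu⟩
    · refine ⟨coeff 0 p * k, e, ?_⟩
      rw [hk, C_mul, ← h1]
      ring
    · have hc : ((u⁻¹ : (MvPolynomial (Mon 6) ℤ)ˣ) : MvPolynomial (Mon 6) ℤ) =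
          C (coeff 0 ((u⁻¹ : (MvPolynomial (Mon 6) ℤ)ˣ) : MvPolynomial (Mon 6) ℤ)) :=
        eq_C_of_dvd_C one_ne_zero (by rw [C_1]; exact isUnit_iff_dvd_one.1 (Units.isUnit _))
      refine ⟨k * coeff 0 ((u⁻¹ : (MvPolynomial (Mon 6) ℤ)ˣ) : MvPolynomial (Mon 6) ℤ), e + 1, ?_⟩
      rw [hk, C_mul, ← hc, ← hu, pow_succ]
      have : (u : MvPolynomial (Mon 6) ℤ) * ((u⁻¹ : (MvPolynomial (Mon 6) ℤ)ˣ) :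
        MvPolynomial (Mon 6) ℤ) = 1 := u.mul_inv
      linear_combination -(p * C k * (p * u) ^ e) * this

/-- A discriminant is primitive: otherwise it would be a nonzero constant, but it vanishes at the
sextic `0`. -/
theorem IsDiscriminant.not_C_dvd {Δ : MvPolynomial (Mon 6) ℤ} (hΔ : IsDiscriminant Δ) {p : ℤ}
    (hp : Prime p) : ¬ C p ∣ Δ := by
  intro h
  obtain ⟨r, hr⟩ := ((prime_C_iff (Mon 6)).2 hp).irreducible.dvd_symm hΔ.irreducible h
  have h0 := (hΔ.zero_iff 0).2 isSingular_zero
  have := congrArg (aeval (0 : Mon 6 → ℂ)) hr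
  rw [map_mul, h0, zero_mul, algHom_C] at this
  exact hp.ne_zero (by simpa using this)

/-- Gauss's lemma for powers of a discriminant. -/
theorem IsDiscriminant.pow_dvd_of_C_pow_dvd {Δ : MvPolynomial (Mon 6) ℤ} (hΔ : IsDiscriminant Δ)
    {p k : ℤ} (hp : Prime p) {n e : ℕ} (h : C (p ^ n) ∣ C k * Δ ^ e) : p ^ n ∣ k := by
  have hp' : Prime (C p : MvPolynomial (Mon 6) ℤ) := (prime_C_iff (Mon 6)).2 hp
  rw [C_pow] at h
  have := hp'.pow_dvd_of_dvd_mul_right n (fun h1 => hΔ.not_C_dvd hp (hp'.dvd_of_dvd_pow h1)) h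
  rw [← C_pow, C_dvd_iff_dvd_coeff] at this
  have h0 := this 0
  rwa [coeff_C, if_pos rfl] at h0

/-- An `e`-th power in which the prime `7` has order `n` forces `e ∣ n`. -/
theorem dvd_of_pow_eq_mul_seven_pow {x : ℤ} {u e n : ℕ} (hu : ¬ 7 ∣ u)
    (h : (x ^ e).natAbs = u * 7 ^ n) : e ∣ n := by
  have hu0 : u ≠ 0 := by
    rintro rfl
    exact hu (dvd_zero 7)
  have := congrArg (fun m => m.factorization 7) h
  simp only [Int.natAbs_pow, Nat.factorization_pow] at this
  rw [Nat.factorization_mul hu0 (by positivity), Nat.Prime.factorization_pow (by norm_num)] at this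
  simp only [Finsupp.smul_apply, Finsupp.add_apply, Finsupp.single_eq_same, smul_eq_mul,
    Nat.factorization_eq_zero_of_not_dvd hu, zero_add] at this
  exact Dvd.intro _ this

/-- The Sylvester determinant of the general sextic is `± 6 ^ 21` times the discriminant. -/
theorem IsDiscriminant.genericDet_eq {Δ : MvPolynomial (Mon 6) ℤ} (hΔ : IsDiscriminant Δ)
    (rows : Fin 45 ≃ Mon 8) (cols : Fin 45 ≃ Col) :
    ∃ ε : ℤˣ, genericDet rows cols = C ((ε : ℤ) * 6 ^ 21) * Δ := by
  obtain ⟨k, e, hk⟩ := hΔ.exists_eq_C_mul_pow (genericDet_ne_zero rows cols)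
    fun c => (aeval_genericDet_eq_zero_iff rows cols c).1
  have h6 : (C (6 ^ 21) : MvPolynomial (Mon 6) ℤ) ∣ C k * Δ ^ e := by
    rw [← hk, C_pow, show (C 6 : MvPolynomial (Mon 6) ℤ) = 6 from map_ofNat C 6]
    exact six_pow_dvd_det_sylvester (fun m => isBlock_standardBlock _ m) rows cols
  have hdvd : (6 : ℤ) ^ 21 ∣ k := by
    have h2 := hΔ.pow_dvd_of_C_pow_dvd (p := 2) Int.prime_two (n := 21)
      ((_root_.map_dvd C (pow_dvd_pow_of_dvd (by norm_num : (2 : ℤ) ∣ 6) 21)).trans h6)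
    have h3 := hΔ.pow_dvd_of_C_pow_dvd (p := 3) Int.prime_three (n := 21)
      ((_root_.map_dvd C (pow_dvd_pow_of_dvd (by norm_num : (3 : ℤ) ∣ 6) 21)).trans h6)
    have hco : IsCoprime ((2 : ℤ) ^ 21) (3 ^ 21) := IsCoprime.pow ⟨-1, 1, by norm_num⟩
    have := hco.mul_dvd h2 h3
    norm_num at this ⊢
    exact this
  obtain ⟨k', rfl⟩ := hdvd
  have hval : ∀ c : Mon 6 → ℤ, aeval c (genericDet rows cols) = 6 ^ 21 * (k' * aeval c Δ ^ e) := by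
    intro c
    rw [hk, map_mul, map_pow, algHom_C]
    simp [mul_assoc]
  have hF : ∀ a : ℤ, ∃ x : ℤ, (k' * x ^ e).natAbs = 6 ^ 54 * a.natAbs ^ 25 := by
    intro a
    obtain ⟨c, ε, h⟩ := aeval_fermat_genericDet a rows cols
    refine ⟨aeval c Δ, ?_⟩
    rw [hval] at h
    have h' : k' * aeval c Δ ^ e = ε * (6 ^ 54 * a ^ 25) :=
      mul_left_cancel₀ (show (6 : ℤ) ^ 21 ≠ 0 by norm_num) (h.trans (by ring))
    rw [h', Int.natAbs_mul, Int.natAbs_mul, Int.natAbs_pow, Int.natAbs_pow, Int.units_natAbs,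
      one_mul]
    rfl
  have hG : ∀ d : ℤ, ∃ x : ℤ, (k' * x ^ e).natAbs = 5 ^ 45 * d.natAbs ^ 21 := by
    intro d
    obtain ⟨c, ε, h⟩ := aeval_chain_genericDet d rows cols
    refine ⟨aeval c Δ, ?_⟩
    rw [hval] at h
    have h' : k' * aeval c Δ ^ e = ε * (5 ^ 45 * d ^ 21) :=
      mul_left_cancel₀ (show (6 : ℤ) ^ 21 ≠ 0 by norm_num) (h.trans (by ring))
    rw [h', Int.natAbs_mul, Int.natAbs_mul, Int.natAbs_pow, Int.natAbs_pow, Int.units_natAbs,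
      one_mul]
    rfl
  -- the Fermat and the chain sextic show that `k'` divides powers of `6` and of `5`
  have hunit : k'.natAbs = 1 := by
    obtain ⟨x, hx⟩ := hF 1
    obtain ⟨y, hy⟩ := hG 1
    rw [Int.natAbs_mul, Int.natAbs_one, one_pow, mul_one] at hx hy
    exact Nat.eq_one_of_dvd_coprimes (Nat.Coprime.pow 54 45 (by norm_num : Nat.Coprime 6 5))
      (Dvd.intro _ hx) (Dvd.intro _ hy)
  -- the order of `7` in the values at the sextics with parameter `7` is `25` and `21`
  have he : e = 1 := by
    obtain ⟨x, hx⟩ := hF 7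
    obtain ⟨y, hy⟩ := hG 7
    rw [Int.natAbs_mul, hunit, one_mul] at hx hy
    have h1 : e ∣ 25 := dvd_of_pow_eq_mul_seven_pow
      (fun h => absurd (Nat.Prime.dvd_of_dvd_pow (by norm_num) h) (by norm_num)) hx
    have h2 : e ∣ 21 := dvd_of_pow_eq_mul_seven_pow
      (fun h => absurd (Nat.Prime.dvd_of_dvd_pow (by norm_num) h) (by norm_num)) hy
    exact Nat.eq_one_of_dvd_coprimes (by norm_num : Nat.Coprime 25 21) h1 h2
  obtain ⟨ε, hε⟩ := Int.isUnit_iff_natAbs_eq.2 hunit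
  refine ⟨ε, ?_⟩
  rw [hk, he, pow_one, hε, mul_comm k']

theorem IsDiscriminant.isHomogeneous {Δ : MvPolynomial (Mon 6) ℤ} (hΔ : IsDiscriminant Δ) :
    Δ.IsHomogeneous 75 := by
  let rows : Fin 45 ≃ Mon 8 := (Fintype.equivFinOfCardEq card_mon_eight).symm
  let cols : Fin 45 ≃ Col := (Fintype.equivFinOfCardEq card_col).symm
  obtain ⟨ε, hε⟩ := hΔ.genericDet_eq rows cols
  intro d hd
  refine isHomogeneous_genericDet rows cols (d := d) ?_
  rw [hε, coeff_C_mul]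
  exact mul_ne_zero (mul_ne_zero ε.ne_zero (by norm_num)) hd

end TernarySextic

end

theorem proposition4p1 :
    -- the discriminant exists
    (∃ Δ : MvPolynomial (TernarySextic.Mon 6) ℤ, TernarySextic.IsDiscriminant Δ) ∧
    -- for the general sextic there are matrices `M_rst`, with entries linear in the coefficients
    (∃ M : TernarySextic.Mon 4 → Matrix (Fin 3) (Fin 3)
          (MvPolynomial (Fin 3) (MvPolynomial (TernarySextic.Mon 6) ℤ)),
      ∀ m, TernarySextic.IsBlock (fun u => (X u : MvPolynomial (TernarySextic.Mon 6) ℤ)) m (M m) ∧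
        ∀ i k a, (coeff a (M m i k)).IsHomogeneous 1) ∧
    ∀ Δ : MvPolynomial (TernarySextic.Mon 6) ℤ, TernarySextic.IsDiscriminant Δ →
      Δ.IsHomogeneous 75 ∧
      -- the sign depends only on `Δ` and on the orderings of the monomials
      ∀ (rows : Fin 45 ≃ TernarySextic.Mon 8) (cols : Fin 45 ≃ TernarySextic.Col),
        ∃ ε : ℤˣ, ∀ (R : Type*) [CommRing R] (c : TernarySextic.Mon 6 → R)
          (M : TernarySextic.Mon 4 → Matrix (Fin 3) (Fin 3) (MvPolynomial (Fin 3) R)),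
          (∀ m, TernarySextic.IsBlock c m (M m)) →
            (TernarySextic.sylvester c M rows cols).det =
              ((ε : ℤ) : R) * 6 ^ 21 * aeval c Δ := by
  refine ⟨TernarySextic.exists_isDiscriminant,
    ⟨TernarySextic.standardBlock _, fun m => ⟨TernarySextic.isBlock_standardBlock _ m, fun i k a =>
      TernarySextic.coeffsHomogeneous_standardBlock_X m i k a⟩⟩, fun Δ hΔ =>
    ⟨hΔ.isHomogeneous, fun rows cols => ?_⟩⟩
  obtain ⟨ε, hε⟩ := hΔ.genericDet_eq rows cols
  refine ⟨ε, fun R _ c M hM => ?_⟩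
  rw [TernarySextic.det_sylvester_eq_aeval_genericDet hM, hε, map_mul, algHom_C,
    eq_intCast, Int.cast_mul, Int.cast_pow, Int.cast_ofNat]
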